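/- Let $\omega\neq 1$ be a nontrivial element (word) of a free group of countable rank. Then there is a positive integer $\mathfrak d(\omega)$, depending only on $\omega$, with the following property. Let $F$ be a field with $\operatorname{char} F>2$ and let $G$ be a group such that the group algebra $FG$ is semiprime (that is, has no nonzero nilpotent two-sided ideal). Let $*$ be the classical involution $\left(\sum_{g}\alpha_g g\right)^*=\sum_{g}\alpha_g g^{-1}$ of $FG$, and suppose that the symmetric units of $FG$ (the units $u$ with $u^*=u$) satisfy the group identity $\omega=1$, i.e. every substitution of symmetric units for the letters of $\omega$ gives the value $1$. Suppose also that $|F|>\mathfrak d(\omega)$. Then the set $t(G)$ of elements of finite order of $G$ is a subgroup of $G$, and one of the following holds: (i) $t(G)$ is abelian and each idempotent of $Ft(G)$ is central in $FG$; (ii) $t(G)$ is a Hamiltonian $2$-group (a nonabelian $2$-group all of whose subgroups are normal) and each symmetric idempotent $e=e^*$ of $Ft(G)$ is central in $FG$. -/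

import Mathlib

universe u v

/-- A (not necessarily commutative) ring is semiprime if it has no nonzero nilpotent
two-sided ideal. -/
def RingIsSemiprime (R : Type*) [Ring R] : Prop :=
  ∀ I : Ideal R, I.IsTwoSided → ∀ n : ℕ, I ^ n = ⊥ → I = ⊥

namespace GroupAlg

/-- The classical involution `∑ α_g g ↦ ∑ α_g g⁻¹` of the group algebra `FG`. -/
noncomputable def invol {F G : Type*} [Field F] [Group G] (x : MonoidAlgebra F G) :
    MonoidAlgebra F G :=
  MonoidAlgebra.mapDomain (fun g : G => g⁻¹) x

/-- The set of symmetric units of `FG`: the units fixed by the classical involution. -/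
def symmUnits (F G : Type*) [Field F] [Group G] : Set (MonoidAlgebra F G)ˣ :=
  {u | invol (u : MonoidAlgebra F G) = u}

/-- A subset `S` of a group satisfies `w = 1`, where `w` is a word in the letters `x₀, x₁, …`
and their inverses: every substitution of elements of `S` for the letters sends `w` to `1`. -/
def SatisfiesWord {U : Type*} [Group U] (S : Set U) (w : FreeGroup ℕ) : Prop :=
  ∀ φ : ℕ → U, (∀ i, φ i ∈ S) → FreeGroup.lift φ w = 1

/-- A Hamiltonian group: nonabelian, with all subgroups normal. -/
def IsHamiltonian (T : Type*) [Group T] : Prop :=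
  (¬ ∀ a b : T, a * b = b * a) ∧ ∀ H : Subgroup T, H.Normal

/-- For a subgroup `T` of `G`, the group algebra `FT` as a subalgebra of `FG`. -/
noncomputable def subgroupAlgebra (F : Type*) {G : Type*} [Field F] [Group G] (T : Subgroup G) :
    Subalgebra F (MonoidAlgebra F G) :=
  (MonoidAlgebra.mapDomainAlgHom F F T.subtype).range

end GroupAlg

/-! Semiprimeness turns nilpotence into vanishing, and the group identity supplies the nilpotence.
If b² = 0, then (1 + λb)(1 + λb*) is a symmetric unit; if a, b are symmetric of square zero, so is
(1 + λa)(1 + μb)(1 + λa). Let the scalars be multiples of a parameter t, generic for the letters of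
ω. Then ω becomes a polynomial in t whose top coefficient is a nonzero scalar times an alternating
product in b, b* (resp. a, b). As F is large that coefficient vanishes, so bb* (resp. ab) is
nilpotent of index bounded by ω. Two consequences carry everything else: symmetric idempotents are
central (`commute_of_isIdempotentElem`), and c*ac = 0 whenever a is symmetric, a² = 0 and c*c = 0
(`star_mul_mul_eq_zero`).

Let p = char F, and let Â be the sum of the elements of a finite subgroup A. If p does not divide
|A|, then |A|⁻¹Â is a symmetric idempotent, hence central, so A is normal. If p divides |A|, then Â²
= 0, and the second consequence gives Â x Â s Â x⁻¹ Â = 0 for symmetric s. From this G has no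
element of order p (`orderOf_ne`): such an element centralises the FC-centre Δ, Δ has infinite
index, and a generic choice of group elements isolates a single term in an identity for D = Â x Â.
Hence all finite cyclic subgroups are normal and t(G) is a subgroup.

If t(G) is abelian, an idempotent e splits into the symmetric idempotent ee* and an idempotent f
with ff* = 0. For f the identity f s f* = 0 holds for symmetric s, and it extends to all s because y
and y⁻¹ lie in different cosets of t(G) when y has infinite order. If t(G) is not abelian, it is
Hamiltonian and contains a quaternion group Q. An element c of odd order commutes with Q; explicit
square-zero elements of FQ, multiplied by c − c⁻¹, then force c = 1. -/

namespace GroupAlg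

/-! ### Polynomials over an algebra, evaluated at central scalars. -/

section PolynomialMethods

open Polynomial

lemma exists_finset_card_of_lt_card {F : Type*} {n : ℕ} (h : (n : ℕ∞) < ENat.card F) :
    ∃ s : Finset F, n < s.card := by
  have h' : ((n + 1 : ℕ) : ℕ∞) ≤ (Set.univ : Set F).encard := by
    rw [Set.encard_univ]
    exact Order.add_one_le_of_lt (by exact_mod_cast h)
  obtain ⟨t, -, ht⟩ := Set.exists_subset_encard_eq h'
  have hfin : t.Finite := Set.finite_of_encard_eq_coe ht
  refine ⟨hfin.toFinset, ?_⟩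
  have := hfin.encard_eq_coe_toFinset_card
  rw [ht] at this
  have : n + 1 = hfin.toFinset.card := by exact_mod_cast this
  omega

section Evaluation

variable {F : Type*} {R : Type*} [Field F] [Ring R] [Algebra F R]

/-- Evaluation of a polynomial over an `F`-algebra at a scalar. -/
noncomputable def evalScalar (R : Type*) [Ring R] [Algebra F R] (t : F) : R[X] →+* R :=
  eval₂RingHom' (RingHom.id R) (algebraMap F R t) fun a => (Algebra.commutes t a).symm

@[simp] lemma evalScalar_C (t : F) (a : R) : evalScalar R t (C a) = a := by
  simp [evalScalar, eval₂RingHom']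

@[simp] lemma evalScalar_X (t : F) : evalScalar R t X = algebraMap F R t := by
  simp [evalScalar, eval₂RingHom']

lemma evalScalar_eq_sum (t : F) (P : R[X]) {n : ℕ} (hn : P.natDegree < n) :
    evalScalar R t P = ∑ k ∈ Finset.range n, t ^ k • P.coeff k := by
  have : evalScalar R t P = eval₂ (RingHom.id R) (algebraMap F R t) P := rfl
  rw [this, eval₂_eq_sum_range' _ hn]
  refine Finset.sum_congr rfl fun k _ => ?_
  rw [← map_pow, RingHom.id_apply, ← Algebra.commutes, ← Algebra.smul_def]

/-- A polynomial over an `F`-algebra which vanishes at more scalars than its degree is zero. -/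
theorem eq_zero_of_evalScalar_eq_zero (P : R[X]) {n : ℕ} (hn : P.natDegree ≤ n)
    (hF : (n : ℕ∞) < ENat.card F) (h : ∀ t : F, evalScalar R t P = 0) : P = 0 := by
  obtain ⟨s, hs⟩ := exists_finset_card_of_lt_card hF
  ext k
  rw [coeff_zero]
  by_cases hk : k < n + 1
  swap
  · exact coeff_eq_zero_of_natDegree_lt (by omega)
  rw [← Module.forall_dual_apply_eq_zero_iff F]
  intro φ
  let p : F[X] := ∑ k ∈ Finset.range (n + 1), C (φ (P.coeff k)) * X ^ k
  have hp : p = 0 := by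
    refine Polynomial.eq_zero_of_natDegree_lt_card_of_eval_eq_zero' p s (fun t _ => ?_)
      (lt_of_le_of_lt (natDegree_sum_le_of_forall_le _ _ fun i hi => ?_) hs)
    · have := congrArg φ (h t)
      rw [evalScalar_eq_sum t P (Nat.lt_succ_of_le hn), map_sum, map_zero] at this
      rw [eval_finsetSum, ← this]
      refine Finset.sum_congr rfl fun i _ => ?_
      rw [eval_mul, eval_C, eval_pow, eval_X, map_smul, smul_eq_mul, mul_comm]
    · exact (natDegree_C_mul_X_pow_le _ _).trans (by simpa [Nat.lt_succ_iff] using hi)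
  have := congrArg (fun q => coeff q k) hp
  simpa [p, finsetSum_coeff, coeff_C_mul, coeff_X_pow, hk] using this

end Evaluation

/-! ### Semiprime rings in terms of elements. -/

section Semiprime

variable {R : Type*} [Ring R]

/-- Elementwise form of semiprimeness. -/
def IsSemiprimeElementwise (R : Type*) [Ring R] : Prop :=
  ∀ a : R, (∀ r, a * r * a = 0) → a = 0

/-- The left ideal generated by aR is the two-sided ideal RaR, which contains a; aRa = 0 makes its
square zero. -/
lemma isSemiprimeElementwise_of_ringIsSemiprime (h : RingIsSemiprime R) :
    IsSemiprimeElementwise R := by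
  intro a ha
  let I : Ideal R := Ideal.span (Set.range fun r => a * r)
  have hmem : ∀ r, a * r ∈ I := fun r => Ideal.subset_span ⟨r, rfl⟩
  have hI : I.IsTwoSided := ⟨fun {x} b hx => by
    induction hx using Submodule.span_induction with
    | mem x hx =>
      obtain ⟨r, rfl⟩ := hx
      simp only [mul_assoc]
      exact hmem _
    | zero => simp
    | add x y _ _ hx hy => rw [add_mul]; exact I.add_mem hx hy
    | smul c x _ hx => rw [smul_eq_mul, mul_assoc]; exact I.mul_mem_left c hx⟩
  have hz₁ : ∀ y ∈ I, ∀ r, a * r * y = 0 := by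
    intro y hy
    induction hy using Submodule.span_induction with
    | zero => simp
    | add y z _ _ hy hz => intro r; rw [mul_add, hy, hz, add_zero]
    | smul c y _ hy => intro r; rw [smul_eq_mul, ← mul_assoc, mul_assoc a, hy]
    | mem y hy => obtain ⟨s, rfl⟩ := hy; intro r; rw [← mul_assoc, ha, zero_mul]
  have hz : ∀ x ∈ I, ∀ y ∈ I, x * y = 0 := by
    intro x hx y hy
    induction hx using Submodule.span_induction with
    | zero => simp
    | add x z _ _ hx hz => rw [add_mul, hx, hz, add_zero]
    | smul d x _ hx => rw [smul_eq_mul, mul_assoc, hx, mul_zero]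
    | mem x hx => obtain ⟨r, rfl⟩ := hx; exact hz₁ y hy r
  have : I = ⊥ := by
    refine h I hI 2 ?_
    rw [show (2 : ℕ) = 1 + 1 from rfl, Ideal.IsTwoSided.pow_succ, Submodule.pow_one, eq_bot_iff, Ideal.mul_le]
    intro x hx y hy
    rw [hz x hx y hy]; exact Submodule.zero_mem _
  have h1 := hmem 1
  rw [this, mul_one] at h1
  simpa using h1

/-- In a semiprime ring `a` vanishes if `a r a r a = 0` for all `r`. -/
lemma IsSemiprimeElementwise.eq_zero_of_mul_mul (h : IsSemiprimeElementwise R) {a : R}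
    (ha : ∀ r, a * r * a * r * a = 0) : a = 0 := by
  refine h a fun r => h _ fun u => ?_
  have h1 := ha (r + u)
  -- Linearise r ↦ r + u; the sign rule then moves u to the front and leaves the factor arara = 0.
  have h2 : a * r * a * u * a = - (a * u * a * r * a) := by
    have e : a * (r + u) * a * (r + u) * a = a * r * a * r * a + a * u * a * u * a +
        (a * r * a * u * a + a * u * a * r * a) := by noncomm_ring
    rw [e, ha, ha, zero_add, zero_add] at h1
    exact eq_neg_of_add_eq_zero_left h1
  calc a * r * a * u * (a * r * a) = (a * r * a * u * a) * r * a := by noncomm_ring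
    _ = - (a * u * (a * r * a * r * a)) := by rw [h2]; noncomm_ring
    _ = 0 := by rw [ha]; simp

end Semiprime

/-! ### Extracting coefficients from identities in a parameter. -/

section Linearisation

variable {F : Type*} {R : Type*} [Field F] [Ring R] [Algebra F R]

/-- First-order part of a power of a quadratic family. -/
lemma pow_mul_mul_pow_mul_eq_zero {n : ℕ} (hF : ((2 * (n + 1) : ℕ) : ℕ∞) < ENat.card F)
    {N A B v : R} (h : ∀ t : F, (N + t • A + t ^ 2 • B) ^ (n + 1) * v = 0)
    (hA : N ^ (n + 1) * A = 0) : N ^ n * A * N ^ n * v = 0 := by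
  let Q : R[X] := C N + C A * X + C B * X ^ 2
  have hQ : Q.natDegree ≤ 2 := by
    refine (natDegree_add_le_of_degree_le (natDegree_add_le_of_degree_le ?_ ?_) ?_)
    · simp
    · exact (natDegree_C_mul_le _ _).trans (natDegree_X_le.trans (by norm_num))
    · exact natDegree_C_mul_X_pow_le _ _
  have hev : ∀ t : F, evalScalar R t Q = N + t • A + t ^ 2 • B := by
    intro t
    simp only [Q, map_add, map_mul, map_pow, evalScalar_C, evalScalar_X]
    rw [← map_pow, ← Algebra.commutes, ← Algebra.commutes, ← Algebra.smul_def,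
      ← Algebra.smul_def]
  have hP : Q ^ (n + 1) * C v = 0 := by
    refine eq_zero_of_evalScalar_eq_zero (n := 2 * (n + 1)) _ ?_ hF fun t => ?_
    · refine natDegree_mul_le.trans ?_
      rw [natDegree_C, add_zero, mul_comm]
      exact natDegree_pow_le.trans (Nat.mul_le_mul_left _ hQ)
    · rw [map_mul, map_pow, hev, evalScalar_C, h]
  have q0 : Q.coeff 0 = N := by simp [Q]
  have q1 : Q.coeff 1 = A := by simp [Q, coeff_X_pow, coeff_C]
  have c0 : ∀ k, (Q ^ k).coeff 0 = N ^ k := by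
    intro k
    induction k with
    | zero => simp
    | succ k ih => rw [pow_succ, mul_coeff_zero, ih, q0, pow_succ]
  have c1 : ∀ k, (Q ^ (k + 1)).coeff 1 = N * (Q ^ k).coeff 1 + A * N ^ k := by
    intro k
    rw [pow_succ', mul_coeff_one, q0, q1, c0]
  have z1 : ∀ k, N ^ (n + 1) * (Q ^ k).coeff 1 = 0 := by
    intro k
    induction k with
    | zero => simp [coeff_one]
    | succ k ih =>
      rw [c1, mul_add, ← mul_assoc, ← pow_succ, pow_succ', mul_assoc, ih, ← mul_assoc, hA]
      simp
  -- The coefficient of t is the sum of the Nⁱ A Nⁿ⁻ⁱ v. Multiplying by Nⁿ on the left kills every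
  -- term with i ≥ 1, since Nⁿ⁺¹A = 0.
  have := congrArg (fun p => coeff p 1) hP
  simp only [coeff_mul_C, coeff_zero, c1, add_mul] at this
  have := congrArg (fun x => N ^ n * x) this
  simp only [mul_zero, mul_add, ← mul_assoc] at this
  rwa [← pow_succ, z1, zero_mul, zero_add] at this

/-- If `P(t) r Q(t) = 0` identically over a semiprime ring, then `P₀ r Qⱼ = 0` for all `j`. -/
lemma coeff_zero_mul_mul_coeff_eq_zero (hR : IsSemiprimeElementwise R) {P Q : R[X]}
    (h : ∀ r, P * C r * Q = 0) (j : ℕ) (r : R) : P.coeff 0 * r * Q.coeff j = 0 := by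
  induction j using Nat.strong_induction_on generalizing r with
  | _ j ih =>
    have hrev : ∀ i < j, ∀ u, Q.coeff i * u * P.coeff 0 = 0 := by
      intro i hi u
      refine hR _ fun s => ?_
      have := ih i hi s
      calc _ = Q.coeff i * u * (P.coeff 0 * s * Q.coeff i) * u * P.coeff 0 := by noncomm_ring
        _ = 0 := by rw [this]; simp
    refine hR _ fun u => ?_
    have h1 := congrArg (fun p => coeff p j) (h r)
    rw [coeff_zero, coeff_mul] at h1
    simp only [coeff_mul_C] at h1
    have h2 := congrArg (fun x => x * u * P.coeff 0) h1
    simp only [zero_mul, Finset.sum_mul] at h2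
    rw [Finset.sum_eq_single (0, j)] at h2
    · calc _ = P.coeff 0 * r * Q.coeff j * u * P.coeff 0 * (r * Q.coeff j) := by noncomm_ring
        _ = 0 := by rw [h2]; simp
    · rintro ⟨a, b⟩ hab hne
      have hab' : a + b = j := by simpa using hab
      have hb : b < j := by
        rcases Nat.eq_zero_or_pos a with rfl | ha
        · exact absurd (by simp at hab'; simp [hab']) hne
        · omega
      have := hrev b hb u
      calc _ = P.coeff a * r * (Q.coeff b * u * P.coeff 0) := by noncomm_ring
        _ = 0 := by rw [this]; simp
    · intro hne; simp at hne

end Linearisation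

/-! ### Semiprime rings with involution. -/

section StarSemiprime

variable {R : Type*} [Ring R] [StarRing R]

/-- From s = r + r* one gets q r* q = −q r q; from s = r q r* one gets q r q r* q = 0. Together, q r
q r q = 0 for all r. -/
lemma eq_zero_of_symm_mul_mul (hR : IsSemiprimeElementwise R) {q : R} (hq : star q = q)
    (h : ∀ s, star s = s → q * s * q = 0) : q = 0 := by
  refine hR.eq_zero_of_mul_mul fun r => ?_
  have h1 : q * (r + star r) * q = 0 := h _ (by simp [add_comm])
  have h2 : q * (r * q * star r) * q = 0 := h _ (by simp [hq, mul_assoc])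
  rw [mul_add, add_mul] at h1
  have h3 : q * star r * q = - (q * r * q) := eq_neg_of_add_eq_zero_right h1
  have h4 : q * (r * q * star r) * q = q * r * (q * star r * q) := by noncomm_ring
  rw [h4, h3, mul_neg, neg_eq_zero] at h2
  rw [← h2]; noncomm_ring

variable {F : Type*} [Field F] [Algebra F R]

/-- Induction on the exponent: replacing s by s + ct and linearising in c gives k t k = 0 for the
symmetric element k = (qs)ⁿq and all symmetric t. -/
lemma eq_zero_of_pow_mul_symm (hR : IsSemiprimeElementwise R)
    (hs : ∀ (t : F) (x : R), star (t • x) = t • star x) {q : R} (hq : star q = q) (n : ℕ)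
    (hF : ((2 * n : ℕ) : ℕ∞) < ENat.card F)
    (h : ∀ s, star s = s → (q * s) ^ n * q = 0) : q = 0 := by
  induction n with
  | zero => simpa using h 0 (star_zero _)
  | succ n ih =>
    refine ih (lt_of_le_of_lt (by exact_mod_cast (by omega : 2 * n ≤ 2 * (n + 1))) hF)
      fun s hs' => ?_
    have hcomm : ∀ k : ℕ, (q * s) ^ k * q = q * (s * q) ^ k := fun k => by
      rw [← mul_pow_mul]
    have hsymm : star ((q * s) ^ n * q) = (q * s) ^ n * q := by
      rw [star_mul, star_pow, star_mul, hs', hq, hcomm]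
    refine eq_zero_of_symm_mul_mul hR hsymm fun t ht => ?_
    have := pow_mul_mul_pow_mul_eq_zero (F := F) (n := n) hF (N := q * s) (A := q * t) (B := 0)
      (v := q) (fun c => ?_) ?_
    · rw [← this]; noncomm_ring
    · rw [smul_zero, add_zero, ← mul_smul_comm, ← mul_add]
      exact h _ (by rw [star_add, hs, hs', ht])
    · rw [← mul_assoc, h s hs', zero_mul]

/-- If `x x*` is nilpotent of index `n + 1` on the corner `e R f`, then `(x x*) ^ n x = 0` there. -/
lemma corner_pow_mul_eq_zero (hR : IsSemiprimeElementwise R) (h2 : ∀ x : R, x + x = 0 → x = 0)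
    (hs : ∀ (t : F) (x : R), star (t • x) = t • star x) {e f : R} (he : star e = e)
    (hf : star f = f) (hee : e * e = e) (hff : f * f = f) {n : ℕ}
    (hF : ((2 * (n + 1) : ℕ) : ℕ∞) < ENat.card F)
    (h : ∀ x, e * x = x → x * f = x → (x * star x) ^ (n + 1) = 0)
    {x : R} (hx : e * x = x) (hx' : x * f = x) : (x * star x) ^ n * x = 0 := by
  set q := (x * star x) ^ n with hq
  have hqs : star q = q := by rw [hq, star_pow, star_mul, star_star]
  have hey : e * (q * x) = q * x := by
    rcases n with _ | n
    · simpa [hq] using hx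
    · rw [hq, pow_succ', ← mul_assoc, ← mul_assoc, ← mul_assoc, hx]
  have hyf : q * x * f = q * x := by rw [mul_assoc, hx']
  -- Linearisation of the nilpotence of (x + ct)(x + ct)* in c.
  have key : ∀ t, e * t = t → t * f = t → q * t * star x * q = - (q * x * star t * q) := by
    intro t ht ht'
    have := pow_mul_mul_pow_mul_eq_zero (F := F) (n := n) hF (N := x * star x)
      (A := t * star x + x * star t) (B := t * star t) (v := 1) (fun c => ?_) ?_
    · rw [mul_one, ← hq, mul_add, add_mul] at this
      rw [mul_assoc q t, mul_assoc q x]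
      exact eq_neg_of_add_eq_zero_left this
    · have h1 := h (x + c • t) (by rw [mul_add, hx, mul_smul_comm, ht])
        (by rw [add_mul, hx', smul_mul_assoc, ht'])
      rw [mul_one, ← h1]
      congr 1
      rw [star_add, hs, mul_add, add_mul, add_mul, smul_mul_assoc, mul_smul_comm,
        smul_mul_assoc, mul_smul_comm, smul_smul, smul_add, pow_two]
      abel
    · rw [h x hx hx', zero_mul]
  -- Put t x* q t for t in `key`. The left side, reduced by `key` twice, is the element in question;
  -- the right side is its negative.
  have key2 : ∀ t, e * t = t → t * f = t → q * x * star t * q * x * star t * q = 0 := by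
    intro t ht ht'
    apply h2
    have h1 := key (t * star x * q * t) (by simp only [← mul_assoc, ht])
      (by simp only [mul_assoc, ht'])
    have h3 : q * (t * star x * q * t) * star x * q =
        (q * t * star x * q) * t * star x * q := by noncomm_ring
    have h4 : (q * x * star t * q) * t * star x * q =
        q * x * star t * (q * t * star x * q) := by noncomm_ring
    have h5 : q * x * star (t * star x * q * t) * q = q * x * star t * q * x * star t * q := by
      simp only [star_mul, star_star, hqs]; noncomm_ring
    rw [h3, key t ht ht', neg_mul, neg_mul, neg_mul, h4, key t ht ht', h5, mul_neg, neg_neg] at h1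
    have h6 : q * x * star t * (q * x * star t * q) = q * x * star t * q * x * star t * q := by
      noncomm_ring
    rw [h6] at h1
    nth_rewrite 1 [h1]
    simp
  refine hR.eq_zero_of_mul_mul fun r => ?_
  have h1 := key2 (e * star r * f) (by simp only [← mul_assoc, hee])
    (by simp only [mul_assoc, hff])
  have h3 : star (e * star r * f) = f * r * e := by
    simp only [star_mul, star_star, he, hf, mul_assoc]
  rw [h3] at h1
  calc q * x * r * (q * x) * r * (q * x)
      = q * x * f * r * (e * (q * x)) * r * (q * x) := by rw [hyf, hey]
    _ = q * x * f * r * (e * (q * x * f)) * r * (e * (q * x)) := by rw [hyf, hey]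
    _ = (q * x * (f * r * e) * q * x * (f * r * e) * q) * x := by noncomm_ring
    _ = 0 := by rw [h1, zero_mul]

end StarSemiprime

/-! ### Quotients by annihilators and the vanishing of corners. -/

section Annihilator

variable {R : Type*} [Ring R]

/-- The two-sided ideal of elements annihilated on the left by `q R`. -/
def annihilatorIdeal (q : R) : Ideal R where
  carrier := {a | ∀ r, q * r * a = 0}
  add_mem' ha hb r := by rw [mul_add, ha, hb, add_zero]
  zero_mem' r := mul_zero _
  smul_mem' c a ha r := by rw [smul_eq_mul, ← mul_assoc, mul_assoc q, ha]

instance (q : R) : (annihilatorIdeal q).IsTwoSided :=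
  ⟨fun b ha r => by rw [← mul_assoc, ha r, zero_mul]⟩

/-- If q R (a u a) = 0 for all u, then (q r a) u (q r a) = 0 is the case of a (u q r) a, so q r a =
0. -/
lemma isSemiprimeElementwise_quotient_annihilatorIdeal (hR : IsSemiprimeElementwise R) (q : R) :
    IsSemiprimeElementwise (R ⧸ annihilatorIdeal q) := by
  intro a ha
  obtain ⟨a, rfl⟩ := Ideal.Quotient.mk_surjective a
  rw [Ideal.Quotient.eq_zero_iff_mem]
  have h : ∀ u r, q * r * (a * u * a) = 0 := by
    intro u
    have := ha (Ideal.Quotient.mk _ u)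
    rw [← map_mul, ← map_mul, Ideal.Quotient.eq_zero_iff_mem] at this
    exact this
  intro r
  refine hR _ fun u => ?_
  rw [← h (u * q * r) r]
  noncomm_ring

variable [StarRing R]

lemma star_mem_annihilatorIdeal (hR : IsSemiprimeElementwise R) {q : R} (hq : star q = q) {a : R}
    (ha : a ∈ annihilatorIdeal q) : star a ∈ annihilatorIdeal q := by
  intro r
  refine hR _ fun u => ?_
  have h := congrArg star (ha (star u))
  simp only [star_mul, star_star, hq, star_zero] at h
  calc _ = q * r * (star a * (u * q)) * r * star a := by noncomm_ring
    _ = 0 := by rw [h]; simp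

/-- The involution induced on the quotient by a two-sided ideal stable under the involution. -/
noncomputable abbrev quotientStarRing (N : Ideal R) [N.IsTwoSided] (h : ∀ a ∈ N, star a ∈ N) :
    StarRing (R ⧸ N) where
  star := Quotient.map' star fun a b hab => by
    rw [Submodule.quotientRel_def] at hab ⊢
    rw [← star_sub]
    exact h _ hab
  star_involutive a := by
    obtain ⟨a, rfl⟩ := Ideal.Quotient.mk_surjective a
    exact congrArg (Ideal.Quotient.mk N) (star_star a)
  star_mul a b := by
    obtain ⟨a, rfl⟩ := Ideal.Quotient.mk_surjective a
    obtain ⟨b, rfl⟩ := Ideal.Quotient.mk_surjective b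
    exact congrArg (Ideal.Quotient.mk N) (star_mul a b)
  star_add a b := by
    obtain ⟨a, rfl⟩ := Ideal.Quotient.mk_surjective a
    obtain ⟨b, rfl⟩ := Ideal.Quotient.mk_surjective b
    exact congrArg (Ideal.Quotient.mk N) (star_add a b)

end Annihilator

section Corner

variable {R : Type*} [Ring R] [StarRing R] {F : Type*} [Field F] [Algebra F R]

/-- Linearising the hypothesis at y gives (yy*)ᵐ⁺¹ r (y*y)ᵐ⁺¹ = 0 for every r. With y = x + cs this
is a polynomial identity in c. By semiprimeness the lowest coefficient of the first factor
annihilates the highest one of the second, which separates x from s. -/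
lemma corner_pow_mul_mul_pow_eq_zero (hR : IsSemiprimeElementwise R)
    (hs : ∀ (t : F) (x : R), star (t • x) = t • star x) {e f : R} (he : star e = e)
    (hf : star f = f) (hee : e * e = e) (hff : f * f = f) {m : ℕ}
    (hF : ((4 * (m + 1) : ℕ) : ℕ∞) < ENat.card F)
    (h : ∀ x, e * x = x → x * f = x → (x * star x) ^ (m + 1) * x = 0)
    {x s : R} (hx : e * x = x) (hx' : x * f = x) (hse : e * s = s) (hsf : s * f = s) (r : R) :
    (x * star x) ^ (m + 1) * r * (star s * s) ^ (m + 1) = 0 := by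
  have hdeg : ∀ a b : R, (C a + C b * X : R[X]).natDegree ≤ 1 := fun a b =>
    natDegree_add_le_of_degree_le (by simp) ((natDegree_C_mul_le _ _).trans natDegree_X_le)
  have hdeg2 : ∀ a b c d : R,
      (((C a + C b * X) * (C c + C d * X) : R[X]) ^ (m + 1)).natDegree ≤ 2 * (m + 1) := by
    intro a b c d
    refine natDegree_pow_le.trans ?_
    rw [mul_comm]
    exact Nat.mul_le_mul_right _ (natDegree_mul_le.trans (add_le_add (hdeg _ _) (hdeg _ _)))
  have hev : ∀ (a b : R) (t : F), evalScalar R t (C a + C b * X) = a + t • b := fun a b t => by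
    rw [map_add, map_mul, evalScalar_C, evalScalar_C, evalScalar_X, ← Algebra.commutes,
      ← Algebra.smul_def]
  have hcorner : ∀ y t : R, e * y = y → y * f = y → e * t = t → t * f = t → ∀ c : F,
      e * (y + c • t) = y + c • t ∧ (y + c • t) * f = y + c • t := by
    intro y t h1 h2 h3 h4 c
    rw [mul_add, add_mul, h1, h2, mul_smul_comm, smul_mul_assoc, h3, h4]
    exact ⟨rfl, rfl⟩
  have hstar : ∀ (y t : R) (c : F), star (y + c • t) = star y + c • star t := fun y t c => by
    rw [star_add, hs]
  have hk : ∀ (p : R[X]) (k : ℕ), (p ^ k).coeff 0 = p.coeff 0 ^ k := fun p k => by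
    induction k with
    | zero => simp
    | succ k ih => rw [pow_succ, mul_coeff_zero, ih, pow_succ]
  have key : ∀ y t, e * y = y → y * f = y → e * t = t → t * f = t →
      (y * star y) ^ (m + 1) * t * (star y * y) ^ (m + 1) = 0 := by
    intro y t hy hy' ht ht'
    have hP : (C y + C t * X : R[X]) *
        ((C (star y) + C (star t) * X) * (C y + C t * X)) ^ (m + 1) = 0 := by
      refine eq_zero_of_evalScalar_eq_zero (n := 4 * (m + 1)) _ ?_ hF fun c => ?_
      · exact (natDegree_mul_le.trans (add_le_add (hdeg _ _) (hdeg2 _ _ _ _))).trans (by omega)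
      · obtain ⟨h1, h2⟩ := hcorner y t hy hy' ht ht' c
        rw [map_mul, map_pow, map_mul, hev, hev, ← hstar, ← mul_pow_mul]
        exact h _ h1 h2
    have h1 := congrArg (fun p => coeff p 1) hP
    rw [coeff_zero, mul_coeff_one] at h1
    have c0 : ∀ (a b : R), (C a + C b * X : R[X]).coeff 0 = a := fun a b => by simp
    have c1 : (C y + C t * X : R[X]).coeff 1 = t := by simp [coeff_C]
    have cp : (((C (star y) + C (star t) * X) * (C y + C t * X) : R[X]) ^ (m + 1)).coeff 0 =
        (star y * y) ^ (m + 1) := by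
      rw [hk, mul_coeff_zero, c0, c0]
    rw [c0, c1, cp] at h1
    have h2 := congrArg (fun z => (y * star y) ^ (m + 1) * z) h1
    simp only [mul_add, mul_zero, ← mul_assoc] at h2
    rwa [h y hy hy', zero_mul, zero_add] at h2
  have key' : ∀ y, e * y = y → y * f = y → ∀ r,
      (y * star y) ^ (m + 1) * r * (star y * y) ^ (m + 1) = 0 := by
    intro y hy hy' r
    have h1 := key y (e * r * f) hy hy' (by simp only [← mul_assoc, hee])
      (by simp only [mul_assoc, hff])
    have h2 : (y * star y) ^ (m + 1) * e = (y * star y) ^ (m + 1) := by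
      rw [pow_succ, mul_assoc, mul_assoc, ← he, ← star_mul, hy]
    have h3 : f * (star y * y) ^ (m + 1) = (star y * y) ^ (m + 1) := by
      rw [pow_succ', ← mul_assoc, ← mul_assoc, ← hf, ← star_mul, hy']
    rw [← h2, ← h3, ← h1]
    noncomm_ring
  let P : R[X] := ((C x + C s * X) * (C (star x) + C (star s) * X)) ^ (m + 1)
  let Q : R[X] := ((C (star x) + C (star s) * X) * (C x + C s * X)) ^ (m + 1)
  have hPQ : ∀ r, P * C r * Q = 0 := by
    intro r
    refine eq_zero_of_evalScalar_eq_zero (n := 4 * (m + 1)) _ ?_ hF fun c => ?_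
    · refine (natDegree_mul_le.trans (add_le_add (natDegree_mul_le.trans
        (add_le_add (hdeg2 _ _ _ _) (natDegree_C _).le)) (hdeg2 _ _ _ _))).trans (by omega)
    · obtain ⟨h1, h2⟩ := hcorner x s hx hx' hse hsf c
      simp only [P, Q, map_mul, map_pow, hev, evalScalar_C, ← hstar]
      exact key' _ h1 h2 r
  have hfin := coeff_zero_mul_mul_coeff_eq_zero hR hPQ ((m + 1) * 2) r
  have hP0 : P.coeff 0 = (x * star x) ^ (m + 1) := by
    simp only [P]
    rw [hk, mul_coeff_zero]
    simp
  have hQ0 : Q.coeff ((m + 1) * 2) = (star s * s) ^ (m + 1) := by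
    simp only [Q]
    rw [coeff_pow_of_natDegree_le (natDegree_mul_le.trans (add_le_add (hdeg _ _) (hdeg _ _)))]
    rw [coeff_mul_add_eq_of_natDegree_le (hdeg _ _) (hdeg _ _)]
    simp [coeff_C]
  rwa [hP0, hQ0] at hfin

/-- If `(x x*) ^ n x = 0` on the corner `e R f` and `n ≥ 1`, then `(x x*) ^ n = 0` there. -/
lemma corner_pow_eq_zero (hR : IsSemiprimeElementwise R) (h2 : (2 : F) ≠ 0)
    (hs : ∀ (t : F) (x : R), star (t • x) = t • star x) {e f : R} (he : star e = e)
    (hf : star f = f) (hee : e * e = e) (hff : f * f = f) {m : ℕ}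
    (hF : ((4 * (m + 1) : ℕ) : ℕ∞) < ENat.card F)
    (h : ∀ x, e * x = x → x * f = x → (x * star x) ^ (m + 1) * x = 0)
    {x : R} (hx : e * x = x) (hx' : x * f = x) : (x * star x) ^ (m + 1) = 0 := by
  set q := (x * star x) ^ (m + 1) with hq
  have hqs : star q = q := by rw [hq, star_pow, star_mul, star_star]
  have hN : ∀ s, e * s = s → s * f = s → (star s * s) ^ (m + 1) ∈ annihilatorIdeal q :=
    fun s h1 h2 r => corner_pow_mul_mul_pow_eq_zero hR hs he hf hee hff hF h hx hx' h1 h2 r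
  let π := Ideal.Quotient.mk (annihilatorIdeal q)
  let _ : StarRing (R ⧸ annihilatorIdeal q) :=
    quotientStarRing _ fun a => star_mem_annihilatorIdeal hR hqs
  have hπ : ∀ a, star (π a) = π (star a) := fun a => rfl
  -- Modulo the annihilator of qR all (s*s)ᵐ⁺¹ vanish, so the previous step applies to the opposite
  -- corner fRe, at x*. It puts (x*x)ᵐ x*, hence q = x (x*x)ᵐ x*, into the annihilator of qR; then
  -- qRq = 0.
  have key := corner_pow_mul_eq_zero (F := F) (R := R ⧸ annihilatorIdeal q)
    (isSemiprimeElementwise_quotient_annihilatorIdeal hR q)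
    (fun x hx => by
      have : (2 : F) • x = 0 := by rw [two_smul, hx]
      exact (smul_eq_zero.1 this).resolve_left h2)
    (fun t a => by
      obtain ⟨a, rfl⟩ := Ideal.Quotient.mk_surjective a
      exact congrArg π (hs t a)) (e := π f) (f := π e)
    (by rw [hπ, hf]) (by rw [hπ, he]) (by rw [← map_mul, hff]) (by rw [← map_mul, hee]) (n := m)
    (lt_of_le_of_lt (by exact_mod_cast (by omega : 2 * (m + 1) ≤ 4 * (m + 1))) hF)
    (fun y hy hy' => by
      obtain ⟨a, rfl⟩ := Ideal.Quotient.mk_surjective y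
      have h1 : Ideal.Quotient.mk (annihilatorIdeal q) a = π (f * a * e) := by
        rw [map_mul, map_mul, hy, hy']
      rw [h1, hπ, ← map_mul, ← map_pow, Ideal.Quotient.eq_zero_iff_mem]
      have := hN (star (f * a * e)) (by simp only [star_mul, he, ← mul_assoc, hee])
        (by simp only [star_mul, hf, mul_assoc, hff])
      rwa [star_star] at this) (x := π (star x))
    (by rw [← map_mul, ← hf, ← star_mul, hx']) (by rw [← map_mul, ← he, ← star_mul, hx])
  rw [hπ, star_star, ← map_mul, ← map_pow, ← map_mul, Ideal.Quotient.eq_zero_iff_mem] at key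
  have hmem : q ∈ annihilatorIdeal q := by
    have h1 : q = x * ((star x * x) ^ m * star x) := by
      rw [hq, pow_succ, ← mul_assoc, mul_pow_mul, mul_assoc]
    have h4 := Ideal.mul_mem_left _ x key
    rwa [← h1] at h4
  exact hR q hmem

/-- If `x x*` is nilpotent of bounded index on the corner `e R f`, then the corner vanishes. -/
theorem corner_eq_zero (hR : IsSemiprimeElementwise R) (h2 : (2 : F) ≠ 0)
    (hs : ∀ (t : F) (x : R), star (t • x) = t • star x) {e f : R} (he : star e = e)
    (hf : star f = f) (hee : e * e = e) (hff : f * f = f) {m : ℕ}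
    (hF : ((4 * m : ℕ) : ℕ∞) < ENat.card F)
    (h : ∀ x, e * x = x → x * f = x → (x * star x) ^ m = 0)
    {x : R} (hx : e * x = x) (hx' : x * f = x) : x = 0 := by
  induction m generalizing x with
  | zero =>
    have := h x hx hx'
    rw [pow_zero] at this
    rw [← mul_one x, this, mul_zero]
  | succ m ih =>
    have h3 : ∀ x, e * x = x → x * f = x → (x * star x) ^ m * x = 0 := fun x hx hx' =>
      corner_pow_mul_eq_zero hR (fun x hx => by
        have : (2 : F) • x = 0 := by rw [two_smul, hx]
        exact (smul_eq_zero.1 this).resolve_left h2) hs he hf hee hff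
        (lt_of_le_of_lt (by exact_mod_cast (by omega : 2 * (m + 1) ≤ 4 * (m + 1))) hF) h hx hx'
    have hF' : ((4 * m : ℕ) : ℕ∞) < ENat.card F :=
      lt_of_le_of_lt (by exact_mod_cast (by omega : 4 * m ≤ 4 * (m + 1))) hF
    -- Each round goes from (xx*)ᵐ⁺¹ = 0 to (xx*)ᵐ x = 0 and then to (xx*)ᵐ = 0. The second half
    -- needs m ≥ 1; for m = 0 the first half already says x = 0.
    rcases m with _ | m
    · simpa using h3 x hx hx'
    · exact ih hF' (fun x hx hx' => corner_pow_eq_zero hR h2 hs he hf hee hff hF' h3 hx hx') hx hx'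

end Corner

/-! ### Words evaluated at products of elements 1 + λℓ with ℓ² = 0. -/

section Alternating

variable {R : Type*} [Ring R]

/-- The alternating product of `n` factors `ℓ b, ℓ (!b), ℓ b, …`. -/
def altProd (ℓ : Bool → R) : Bool → ℕ → R
  | _, 0 => 1
  | b, n + 1 => ℓ b * altProd ℓ (!b) n

lemma altProd_add (ℓ : Bool → R) (n : ℕ) :
    ∀ b, ∃ c, ∀ k, altProd ℓ b (n + k) = altProd ℓ b n * altProd ℓ c k := by
  induction n with
  | zero => intro b; exact ⟨b, fun k => by simp [altProd]⟩
  | succ n ih =>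
    intro b
    obtain ⟨c, hc⟩ := ih (!b)
    refine ⟨c, fun k => ?_⟩
    rw [Nat.add_right_comm, altProd, altProd, hc, mul_assoc]

lemma altProd_eq_zero_of_le {ℓ : Bool → R} {b : Bool} {n m : ℕ} (h : altProd ℓ b n = 0)
    (hnm : n ≤ m) : altProd ℓ b m = 0 := by
  obtain ⟨c, hc⟩ := altProd_add ℓ n b
  obtain ⟨k, rfl⟩ := Nat.exists_eq_add_of_le hnm
  rw [hc, h, zero_mul]

lemma altProd_two_mul (ℓ : Bool → R) (k : ℕ) :
    altProd ℓ true (2 * k) = (ℓ true * ℓ false) ^ k := by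
  induction k with
  | zero => simp [altProd]
  | succ k ih =>
    rw [show 2 * (k + 1) = 2 * k + 1 + 1 by ring, altProd, altProd, pow_succ', mul_assoc]
    simp [ih]

lemma pow_eq_zero_of_altProd_eq_zero {ℓ : Bool → R} {b : Bool} {n k : ℕ}
    (h : altProd ℓ b n = 0) (hnk : n + 1 ≤ 2 * k) : (ℓ true * ℓ false) ^ k = 0 := by
  rw [← altProd_two_mul]
  cases b
  · refine altProd_eq_zero_of_le (n := n + 1) ?_ hnk
    rw [altProd, Bool.not_true, h, mul_zero]
  · exact altProd_eq_zero_of_le h (by omega)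

variable {F : Type*} [Field F] [Algebra F R]

/-- `P` has degree at most `n`, and its coefficient of degree `n` is a nonzero scalar times the
alternating product of length `n` starting with `ℓ b`. -/
def HasAltLead (F : Type*) [Field F] [Algebra F R] (ℓ : Bool → R) (b : Bool) (n : ℕ)
    (P : R[X]) : Prop :=
  P.natDegree ≤ n ∧ ∃ κ : F, κ ≠ 0 ∧ P.coeff n = κ • altProd ℓ b n

lemma hasAltLead_one (ℓ : Bool → R) (b : Bool) : HasAltLead F ℓ b 0 1 :=
  ⟨by simp, 1, one_ne_zero, by simp [altProd]⟩

/-- The elementary factor `1 + a ℓ_b X`. -/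
noncomputable def elemFactor (ℓ : Bool → R) (b : Bool) (a : F) : R[X] := 1 + C (a • ℓ b) * X

lemma elemFactor_natDegree_le (ℓ : Bool → R) (b : Bool) (a : F) :
    (elemFactor ℓ b a).natDegree ≤ 1 :=
  natDegree_add_le_of_degree_le (by simp) ((natDegree_C_mul_le _ _).trans natDegree_X_le)

lemma HasAltLead.elemFactor_mul {ℓ : Bool → R} {b : Bool} {n : ℕ} {P : R[X]}
    (h : HasAltLead F ℓ (!b) n P) {a : F} (ha : a ≠ 0) :
    HasAltLead F ℓ b (n + 1) (elemFactor ℓ b a * P) := by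
  obtain ⟨hd, κ, hκ, hc⟩ := h
  refine ⟨natDegree_mul_le.trans ?_, a * κ, mul_ne_zero ha hκ, ?_⟩
  · rw [add_comm]; exact add_le_add hd (elemFactor_natDegree_le _ _ _)
  · rw [add_comm n 1, coeff_mul_add_eq_of_natDegree_le (elemFactor_natDegree_le _ _ _) hd, hc,
      add_comm 1 n, altProd]
    simp [elemFactor, coeff_one, smul_smul, mul_comm]

lemma elemFactor_mul_elemFactor {ℓ : Bool → R} (hℓ : ∀ b, ℓ b * ℓ b = 0) (b : Bool) (a a' : F) :
    elemFactor ℓ b a * elemFactor ℓ b a' = elemFactor ℓ b (a + a') := by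
  have h : C (a • ℓ b) * X * (C (a' • ℓ b) * X) = (0 : R[X]) := by
    rw [mul_assoc, ← mul_assoc X, X_mul_C, mul_assoc, ← mul_assoc, ← C_mul]
    simp [hℓ]
  simp only [elemFactor, add_mul, mul_add, one_mul, mul_one, h, add_smul, C_add]
  abel

lemma elemFactor_zero (ℓ : Bool → R) (b : Bool) : elemFactor ℓ b (0 : F) = 1 := by
  simp [elemFactor]

lemma elemFactor_mul_neg {ℓ : Bool → R} (hℓ : ∀ b, ℓ b * ℓ b = 0) (b : Bool) {a a' : F}
    (h : a + a' = 0) (P : R[X]) : elemFactor ℓ b a * (elemFactor ℓ b a' * P) = P := by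
  rw [← mul_assoc, elemFactor_mul_elemFactor hℓ, h, elemFactor_zero, one_mul]

lemma evalScalar_elemFactor (ℓ : Bool → R) (b : Bool) (a t : F) :
    evalScalar R t (elemFactor ℓ b a) = 1 + (a * t) • ℓ b := by
  rw [elemFactor, map_add, map_one, map_mul, evalScalar_C, evalScalar_X, ← Algebra.commutes,
    ← Algebra.smul_def, smul_smul, mul_comm]

/-- `a` or `-a` according to the sign of a letter. -/
def signed (α : ℕ → F) (x : ℕ × Bool) : F := cond x.2 (α x.1) (-α x.1)

/-- The substitution of the product of two transvections for the letters of a word. -/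
noncomputable def pairFactor (ℓ : Bool → R) (α : ℕ → F) (x : ℕ × Bool) : R[X] :=
  elemFactor ℓ x.2 (signed α x) * elemFactor ℓ (!x.2) (signed α x)

/-- The substitution of a palindromic product of transvections for the letters of a word. -/
noncomputable def tripleFactor (ℓ : Bool → R) (α : ℕ → F) (x : ℕ × Bool) : R[X] :=
  elemFactor ℓ true (signed α x) * (elemFactor ℓ false (signed (fun _ => (1 : F)) x) *
    elemFactor ℓ true (signed α x))

/-- Scalars in general position with respect to a set of indices. -/
def IsGeneric (α : ℕ → F) (S : Set ℕ) : Prop :=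
  ∀ i ∈ S, ∀ j ∈ S, α i + α j ≠ 0 ∧ (i ≠ j → α i ≠ α j)

lemma IsGeneric.ne_zero {α : ℕ → F} {S : Set ℕ} (h : IsGeneric α S) {i : ℕ} (hi : i ∈ S) :
    α i ≠ 0 := fun h0 => (h i hi i hi).1 (by simp [h0])

lemma IsGeneric.signed_ne_zero {α : ℕ → F} {S : Set ℕ} (h : IsGeneric α S) {x : ℕ × Bool}
    (hx : x.1 ∈ S) : signed α x ≠ 0 := by
  rcases x with ⟨i, _ | _⟩
  · simpa [signed] using h.ne_zero hx
  · simpa [signed] using h.ne_zero hx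

/-- Adjacent factors with the same ℓ merge by adding coefficients. For letters not inverse to each
other the sum is ±(αᵢ + αⱼ), or ±(αᵢ − αⱼ) with i ≠ j, so no merged factor disappears. -/
lemma IsGeneric.signed_add_ne_zero {α : ℕ → F} {S : Set ℕ} (h : IsGeneric α S)
    {x y : ℕ × Bool} (hx : x.1 ∈ S) (hy : y.1 ∈ S) (hxy : x.1 = y.1 → x.2 = y.2) :
    signed α x + signed α y ≠ 0 := by
  rcases x with ⟨i, _ | _⟩ <;> rcases y with ⟨j, _ | _⟩ <;>
    simp only [signed, cond_true, cond_false] at hx hy hxy ⊢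
  · rw [← neg_add]; exact neg_ne_zero.2 (h i hx j hy).1
  · intro h0
    exact (h j hy i hx).2 (fun h1 => by simpa using hxy h1.symm)
      (by rwa [add_comm, ← sub_eq_add_neg, sub_eq_zero] at h0)
  · intro h0
    exact (h i hx j hy).2 (fun h1 => by simpa using hxy h1)
      (by rwa [← sub_eq_add_neg, sub_eq_zero] at h0)
  · exact (h i hx j hy).1

lemma exists_isGeneric (h2 : (2 : F) ≠ 0) (S : Finset ℕ)
    (hF : ((2 * S.card + 1 : ℕ) : ℕ∞) < ENat.card F) : ∃ α : ℕ → F, IsGeneric α S := by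
  classical
  induction S using Finset.induction_on with
  | empty => exact ⟨fun _ => 0, by simp [IsGeneric]⟩
  | insert k S hk ih =>
    rw [Finset.card_insert_of_notMem hk] at hF
    obtain ⟨α, hα⟩ := ih (lt_of_le_of_lt (by exact_mod_cast (by omega)) hF)
    obtain ⟨s, hs⟩ := exists_finset_card_of_lt_card hF
    -- A new scalar must avoid 0 (so that its double is nonzero) and ± each earlier one: 2|S| + 1
    -- values.
    let bad : Finset F := insert 0 (S.image α ∪ S.image fun i => -α i)
    have hbad : bad.card ≤ 2 * S.card + 1 := by
      refine (Finset.card_insert_le _ _).trans ?_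
      have := Finset.card_union_le (S.image α) (S.image fun i => -α i)
      have h3 := Finset.card_image_le (s := S) (f := α)
      have h4 := Finset.card_image_le (s := S) (f := fun i => -α i)
      omega
    obtain ⟨v, -, hv⟩ := Finset.exists_mem_notMem_of_card_lt_card (s := bad) (t := s) (by omega)
    simp only [bad, Finset.mem_insert, Finset.mem_union, Finset.mem_image, not_or, not_exists,
      not_and] at hv
    obtain ⟨hv0, hv1, hv2⟩ := hv
    refine ⟨Function.update α k v, ?_⟩
    have hu : ∀ i ∈ S, Function.update α k v i = α i := fun i hi =>
      Function.update_of_ne (by rintro rfl; exact hk hi) _ _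
    intro i hi j hj
    rw [Finset.mem_coe, Finset.mem_insert] at hi hj
    rcases hi with rfl | hi <;> rcases hj with rfl | hj
    · simp only [Function.update_self, ← two_mul]
      exact ⟨mul_ne_zero h2 hv0, fun h => absurd rfl h⟩
    · rw [Function.update_self, hu j hj]
      exact ⟨fun h => hv2 j hj (eq_neg_of_add_eq_zero_left h).symm, fun _ h => hv1 j hj h.symm⟩
    · rw [Function.update_self, hu i hi]
      exact ⟨fun h => hv2 i hi (eq_neg_of_add_eq_zero_right h).symm, fun _ h => hv1 i hi h⟩
    · rw [hu i hi, hu j hj]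
      exact hα i hi j hj

/-- Neighbouring letters of equal sign already alternate; those of opposite sign meet in equal
factors, which merge. The first factor is kept apart from `M` so that the preceding letter can merge
with it. The bound 3 · length is wasteful here but is shared with the triples below. -/
lemma prod_pairFactor {ℓ : Bool → R} (hℓ : ∀ b, ℓ b * ℓ b = 0) {α : ℕ → F} {S : Set ℕ}
    (hα : IsGeneric α S) (x : ℕ × Bool) (L : List (ℕ × Bool))
    (hL : FreeGroup.IsReduced (x :: L)) (hS : ∀ y ∈ x :: L, y.1 ∈ S) :
    ∃ n M, n + 1 ≤ 3 * (x :: L).length ∧ HasAltLead F ℓ (!x.2) n M ∧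
      ((x :: L).map (pairFactor ℓ α)).prod = elemFactor ℓ x.2 (signed α x) * M := by
  induction L generalizing x with
  | nil =>
    refine ⟨1, elemFactor ℓ (!x.2) (signed α x) * 1, by simp,
      (hasAltLead_one ℓ _).elemFactor_mul (hα.signed_ne_zero (hS x (by simp))), ?_⟩
    simp [pairFactor]
  | cons y L ih =>
    obtain ⟨hxy, hL'⟩ := FreeGroup.isReduced_cons_cons.1 hL
    obtain ⟨n, M, hn, hM, hprod⟩ := ih y hL' fun z hz => hS z (List.mem_cons_of_mem _ hz)
    have hx := hS x (by simp)
    have hy := hS y (by simp)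
    rw [List.map_cons, List.prod_cons, hprod, pairFactor, mul_assoc]
    rcases eq_or_ne x.2 y.2 with hb | hb
    · refine ⟨n + 1 + 1, _, ?_, HasAltLead.elemFactor_mul ?_ (hα.signed_ne_zero hx), rfl⟩
      · simp only [List.length_cons] at hn ⊢; omega
      · rw [Bool.not_not, hb]
        exact hM.elemFactor_mul (hα.signed_ne_zero hy)
    · have hb' : y.2 = !x.2 := by
        revert hb; cases x.2 <;> cases y.2 <;> simp
      refine ⟨n + 1, _, ?_, ?_, by rw [hb']⟩
      · simp only [List.length_cons] at hn ⊢; omega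
      · rw [← mul_assoc, elemFactor_mul_elemFactor hℓ]
        rw [hb'] at hM
        exact hM.elemFactor_mul (hα.signed_add_ne_zero hx hy hxy)

/-- Every letter starts and ends with `ℓ true`, so a merge takes place at each junction, while the
middle factors keep coefficients ±1. -/
lemma prod_tripleFactor {ℓ : Bool → R} (hℓ : ∀ b, ℓ b * ℓ b = 0) {α : ℕ → F} {S : Set ℕ}
    (hα : IsGeneric α S) (x : ℕ × Bool) (L : List (ℕ × Bool))
    (hL : FreeGroup.IsReduced (x :: L)) (hS : ∀ y ∈ x :: L, y.1 ∈ S) :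
    ∃ n M, n + 1 ≤ 3 * (x :: L).length ∧ HasAltLead F ℓ false n M ∧
      ((x :: L).map (tripleFactor ℓ α)).prod = elemFactor ℓ true (signed α x) * M := by
  have h1 : ∀ x : ℕ × Bool, signed (fun _ => (1 : F)) x ≠ 0 := by
    rintro ⟨i, _ | _⟩ <;> simp [signed]
  induction L generalizing x with
  | nil =>
    refine ⟨2, elemFactor ℓ false (signed (fun _ => (1 : F)) x) *
      (elemFactor ℓ true (signed α x) * 1), by simp,
      HasAltLead.elemFactor_mul ((hasAltLead_one ℓ _).elemFactor_mul
        (hα.signed_ne_zero (hS x (by simp)))) (h1 x), ?_⟩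
    simp [tripleFactor]
  | cons y L ih =>
    obtain ⟨hxy, hL'⟩ := FreeGroup.isReduced_cons_cons.1 hL
    obtain ⟨n, M, hn, hM, hprod⟩ := ih y hL' fun z hz => hS z (List.mem_cons_of_mem _ hz)
    have hx := hS x (by simp)
    have hy := hS y (by simp)
    rw [List.map_cons, List.prod_cons, hprod, tripleFactor, mul_assoc, mul_assoc]
    refine ⟨n + 1 + 1, _, ?_, HasAltLead.elemFactor_mul ?_ (h1 x), rfl⟩
    · simp only [List.length_cons] at hn ⊢; omega
    · rw [← mul_assoc, elemFactor_mul_elemFactor hℓ]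
      exact HasAltLead.elemFactor_mul (b := true) hM (hα.signed_add_ne_zero hx hy hxy)

/-- The value of the word minus 1 is a polynomial vanishing at more scalars than its degree. Its
coefficient in the positive degree n + 1, untouched by the 1, is a nonzero scalar times an
alternating product. -/
lemma pow_eq_zero_of_prod {w : FreeGroup ℕ} (hw1 : w ≠ 1) {ℓ : Bool → R}
    (hF : ((3 * w.toWord.length : ℕ) : ℕ∞) < ENat.card F) {U : ℕ × Bool → R[X]}
    (hev : ∀ t : F, evalScalar R t (w.toWord.map U).prod = 1)
    (hprod : ∀ x L, w.toWord = x :: L → ∃ n M b, ∃ a : F, a ≠ 0 ∧ n + 1 ≤ 3 * (x :: L).length ∧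
      HasAltLead F ℓ (!b) n M ∧ ((x :: L).map U).prod = elemFactor ℓ b a * M) :
    (ℓ true * ℓ false) ^ (3 * w.toWord.length) = 0 := by
  have hne : w.toWord ≠ [] := fun h => hw1 (FreeGroup.toWord_eq_nil_iff.1 h)
  obtain ⟨x, L, hxL⟩ := List.exists_cons_of_ne_nil hne
  obtain ⟨n, M, b, a, ha, hn, hM, hp⟩ := hprod x L hxL
  obtain ⟨hd, κ, hκ, hc⟩ := hM.elemFactor_mul ha
  rw [hxL] at hF hev ⊢
  have h1 : ((x :: L).map U).prod - 1 = 0 := by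
    refine eq_zero_of_evalScalar_eq_zero _ ?_ hF fun t => ?_
    · refine (natDegree_sub_le _ _).trans ?_
      rw [hp, natDegree_one]
      exact max_le (hd.trans hn) (Nat.zero_le _)
    · rw [map_sub, hev, map_one, sub_self]
  have h2 := congrArg (fun p => coeff p (n + 1)) h1
  simp only [coeff_sub, hp, hc, coeff_one, coeff_zero] at h2
  rw [if_neg (by omega), sub_zero] at h2
  refine pow_eq_zero_of_altProd_eq_zero ((smul_eq_zero.1 h2).resolve_left hκ) ?_
  simp only [List.length_cons] at hn ⊢
  omega

end Alternating

/-! ### Consequences of a group identity for the symmetric units. -/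

section Word

variable {R : Type*} [Ring R] [StarRing R] {F : Type*} [Field F] [Algebra F R]

/-- The symmetric units of a ring with involution. -/
def symmetricUnits (R : Type*) [Ring R] [StarRing R] : Set Rˣ := {u | star (u : R) = u}

lemma evalScalar_prod_eq_one {w : FreeGroup ℕ} (hw : SatisfiesWord (symmetricUnits R) w)
    {U : ℕ × Bool → R[X]} (hU : ∀ i, U (i, true) * U (i, false) = 1)
    (hU' : ∀ i, U (i, false) * U (i, true) = 1)
    (hsymm : ∀ (t : F) i, star (evalScalar R t (U (i, true))) = evalScalar R t (U (i, true)))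
    (t : F) : evalScalar R t (w.toWord.map U).prod = 1 := by
  let φ : ℕ → Rˣ := fun i =>
    { val := evalScalar R t (U (i, true))
      inv := evalScalar R t (U (i, false))
      val_inv := by rw [← map_mul, hU, map_one]
      inv_val := by rw [← map_mul, hU', map_one] }
  have h := hw φ fun i => hsymm t i
  rw [← FreeGroup.mk_toWord (x := w), FreeGroup.lift_mk] at h
  have h' := congrArg (Units.coeHom R) h
  rw [map_list_prod, map_one, List.map_map] at h'
  rw [map_list_prod, List.map_map, ← h']
  congr 1
  refine List.map_congr_left fun x _ => ?_
  rcases x with ⟨i, _ | _⟩ <;> rfl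

/-- A semiprime algebra with involution over a large field of characteristic not two, whose
symmetric units satisfy the group identity `w = 1`. -/
structure SymmetricIdentity (F : Type*) (R : Type*) [Field F] [Ring R] [Algebra F R] [StarRing R]
    (w : FreeGroup ℕ) : Prop where
  ne_one : w ≠ 1
  word : SatisfiesWord (symmetricUnits R) w
  semiprime : IsSemiprimeElementwise R
  two_ne_zero : (2 : F) ≠ 0
  star_smul : ∀ (t : F) (x : R), star (t • x) = t • star x
  lt_card : ((12 * (w.toWord.length + 1) : ℕ) : ℕ∞) < ENat.card F

namespace SymmetricIdentity

variable {w : FreeGroup ℕ} (H : SymmetricIdentity F R w)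
include H

lemma coe_lt_card {n : ℕ} (hn : n ≤ 12 * (w.toWord.length + 1)) : (n : ℕ∞) < ENat.card F :=
  lt_of_le_of_lt (by exact_mod_cast hn) H.lt_card

lemma exists_isGeneric_toWord : ∃ α : ℕ → F, ∀ L, w.toWord = L →
    IsGeneric α {i | ∃ y ∈ L, y.1 = i} := by
  classical
  obtain ⟨α, hα⟩ := exists_isGeneric H.two_ne_zero (w.toWord.map Prod.fst).toFinset (by
    refine H.coe_lt_card ?_
    have := List.toFinset_card_le (w.toWord.map Prod.fst)
    rw [List.length_map] at this
    omega)
  refine ⟨α, fun L hL => ?_⟩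
  subst hL
  convert hα using 2
  ext i
  simp

/-- If `b² = 0` then `b b*` is nilpotent, of index bounded by the word. -/
theorem mul_star_pow_eq_zero {b : R} (hb : b * b = 0) :
    (b * star b) ^ (3 * w.toWord.length) = 0 := by
  obtain ⟨α, hα⟩ := H.exists_isGeneric_toWord
  let ℓ : Bool → R := fun c => cond c b (star b)
  have hℓ : ∀ c, ℓ c * ℓ c = 0 := by
    rintro (_ | _)
    · change star b * star b = 0
      rw [← star_mul, hb, star_zero]
    · exact hb
  refine pow_eq_zero_of_prod (F := F) H.ne_one (ℓ := ℓ) (H.coe_lt_card (by omega))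
    (U := pairFactor ℓ α) (evalScalar_prod_eq_one H.word (fun i => ?_) (fun i => ?_)
      fun t i => ?_) fun x L hxL => ?_
  · simp only [pairFactor, signed, cond_true, cond_false, Bool.not_true, Bool.not_false]
    rw [mul_assoc, elemFactor_mul_neg hℓ _ (add_neg_cancel _), elemFactor_mul_elemFactor hℓ,
      add_neg_cancel, elemFactor_zero]
  · simp only [pairFactor, signed, cond_true, cond_false, Bool.not_true, Bool.not_false]
    rw [mul_assoc, elemFactor_mul_neg hℓ _ (neg_add_cancel _), elemFactor_mul_elemFactor hℓ,
      neg_add_cancel, elemFactor_zero]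
  · simp only [pairFactor, map_mul, evalScalar_elemFactor, star_mul, star_add, star_one,
      H.star_smul, Bool.not_true]
    simp [ℓ]
  · have hα' := hα _ hxL
    have hred : FreeGroup.IsReduced (x :: L) := hxL ▸ FreeGroup.isReduced_toWord
    obtain ⟨n, M, h1, h2, h3⟩ := prod_pairFactor hℓ hα' x L hred fun y hy => ⟨y, hy, rfl⟩
    exact ⟨n, M, x.2, signed α x, hα'.signed_ne_zero ⟨x, by simp, rfl⟩, h1, h2, h3⟩

/-- Products of two symmetric elements of square zero are nilpotent, of index bounded by the
word. -/
theorem mul_pow_eq_zero {a b : R} (ha : a * a = 0) (hb : b * b = 0) (ha' : star a = a)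
    (hb' : star b = b) : (a * b) ^ (3 * w.toWord.length) = 0 := by
  obtain ⟨α, hα⟩ := H.exists_isGeneric_toWord
  let ℓ : Bool → R := fun c => cond c a b
  have hℓ : ∀ c, ℓ c * ℓ c = 0 := by
    rintro (_ | _)
    · exact hb
    · exact ha
  have hℓ' : ∀ c, star (ℓ c) = ℓ c := by
    rintro (_ | _)
    · exact hb'
    · exact ha'
  refine pow_eq_zero_of_prod (F := F) H.ne_one (ℓ := ℓ) (H.coe_lt_card (by omega))
    (U := tripleFactor ℓ α) (evalScalar_prod_eq_one H.word (fun i => ?_) (fun i => ?_)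
      fun t i => ?_) fun x L hxL => ?_
  · simp only [tripleFactor, signed, cond_true, cond_false]
    rw [mul_assoc, mul_assoc, elemFactor_mul_neg hℓ _ (add_neg_cancel _),
      elemFactor_mul_neg hℓ _ (add_neg_cancel _), elemFactor_mul_elemFactor hℓ,
      add_neg_cancel, elemFactor_zero]
  · simp only [tripleFactor, signed, cond_true, cond_false]
    rw [mul_assoc, mul_assoc, elemFactor_mul_neg hℓ _ (neg_add_cancel _),
      elemFactor_mul_neg hℓ _ (neg_add_cancel _), elemFactor_mul_elemFactor hℓ,
      neg_add_cancel, elemFactor_zero]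
  · simp only [tripleFactor, map_mul, evalScalar_elemFactor, star_mul, star_add, star_one,
      H.star_smul, hℓ', mul_assoc]
  · have hα' := hα _ hxL
    have hred : FreeGroup.IsReduced (x :: L) := hxL ▸ FreeGroup.isReduced_toWord
    obtain ⟨n, M, h1, h2, h3⟩ := prod_tripleFactor hℓ hα' x L hred fun y hy => ⟨y, hy, rfl⟩
    exact ⟨n, M, true, signed α x, hα'.signed_ne_zero ⟨x, by simp, rfl⟩, h1, h2, h3⟩

/-- If `a` is symmetric of square zero and `c* c = 0`, then `c* a c = 0`. -/
theorem star_mul_mul_eq_zero {a c : R} (ha : a * a = 0) (ha' : star a = a)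
    (hc : star c * c = 0) : star c * a * c = 0 := by
  refine eq_zero_of_pow_mul_symm H.semiprime H.star_smul (by simp [ha', mul_assoc])
    (3 * w.toWord.length + 1) (H.coe_lt_card (by omega)) fun s hs => ?_
  -- For each symmetric s, csc* is symmetric of square zero, so a(csc*) is nilpotent. Rotating the
  -- product makes c*ac · s nilpotent with exponent one higher.
  have hb : c * s * star c * (c * s * star c) = 0 := by
    calc _ = c * s * (star c * c) * s * star c := by noncomm_ring
      _ = 0 := by rw [hc]; simp
  have h := H.mul_pow_eq_zero ha hb ha' (by simp [hs, mul_assoc])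
  have h1 : (star c * a * c * s) ^ (3 * w.toWord.length + 1) =
      star c * (a * (c * s * star c)) ^ (3 * w.toWord.length) * (a * c * s) := by
    have e1 : star c * a * c * s = star c * (a * c * s) := by noncomm_ring
    have e2 : a * (c * s * star c) = a * c * s * star c := by noncomm_ring
    rw [e1, e2, pow_succ', mul_assoc (star c), ← mul_pow_mul, ← mul_assoc (star c)]
  rw [h1, h]
  simp

/-- Symmetric idempotents are central. -/
theorem commute_of_isIdempotentElem {e : R} (he : IsIdempotentElem e) (he' : star e = e) (r : R) :
    Commute e r := by
  have hff : (1 - e) * (1 - e) = 1 - e := he.one_sub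
  -- Elements of eR(1 − e) square to zero, so the corner theorem applies; the involution then kills
  -- (1 − e)Re.
  have h1 : ∀ r, e * r * (1 - e) = 0 := fun r => by
    refine corner_eq_zero H.semiprime H.two_ne_zero H.star_smul he' (f := 1 - e)
      (by rw [star_sub, star_one, he']) he hff (m := 3 * w.toWord.length)
      (H.coe_lt_card (by omega)) (fun x hx hx' => H.mul_star_pow_eq_zero ?_)
      (by simp only [← mul_assoc, he.eq]) (by rw [mul_assoc, hff])
    rw [← hx]
    nth_rewrite 1 [← hx']
    have : (1 - e) * e = 0 := by rw [sub_mul, one_mul, he.eq, sub_self]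
    calc _ = e * x * ((1 - e) * e) * x := by noncomm_ring
      _ = 0 := by rw [this]; simp
  have h2 := h1 r
  have h3 := congrArg star (h1 (star r))
  simp only [star_mul, star_star, star_sub, star_one, he', star_zero] at h3
  rw [mul_sub, mul_one, sub_eq_zero] at h2
  rw [sub_mul, one_mul, sub_eq_zero] at h3
  rw [commute_iff_eq, h2, h3, mul_assoc]

end SymmetricIdentity

end Word

end PolynomialMethods

open scoped commutatorElement

/-! ### The FC-centre. -/

section FCCenter

variable (G : Type*) [Group G]

/-- The FC-centre: the elements with finitely many conjugates. -/
def fcCenter : Subgroup G where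
  carrier := {g | (Subgroup.centralizer {g}).FiniteIndex}
  mul_mem' {a b} ha hb := by
    have : (Subgroup.centralizer {a}).FiniteIndex := ha
    have : (Subgroup.centralizer {b}).FiniteIndex := hb
    have h : Subgroup.centralizer {a} ⊓ Subgroup.centralizer {b} ≤ Subgroup.centralizer {a * b} := by
      intro x hx
      obtain ⟨h1, h2⟩ := Subgroup.mem_inf.1 hx
      rw [Subgroup.mem_centralizer_singleton_iff] at h1 h2
      rw [Subgroup.mem_centralizer_singleton_iff, ← mul_assoc, h1, mul_assoc, h2, mul_assoc]
    exact Subgroup.finiteIndex_of_le h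
  one_mem' := by
    have h : Subgroup.centralizer {(1 : G)} = ⊤ := by
      ext x; simp [Subgroup.mem_centralizer_singleton_iff]
    change (Subgroup.centralizer {(1 : G)}).FiniteIndex
    rw [h]; infer_instance
  inv_mem' {a} ha := by
    have : (Subgroup.centralizer {a}).FiniteIndex := ha
    refine Subgroup.finiteIndex_of_le (H := Subgroup.centralizer {a}) fun x hx => ?_
    rw [Subgroup.mem_centralizer_singleton_iff] at hx ⊢
    exact (Commute.inv_right (show Commute x a from hx)).eq

variable {G}

lemma mem_fcCenter {g : G} : g ∈ fcCenter G ↔ (Subgroup.centralizer {g}).FiniteIndex := Iff.rfl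

instance : (fcCenter G).Normal where
  conj_mem a ha x := by
    rw [mem_fcCenter] at ha ⊢
    have h : Subgroup.centralizer {x * a * x⁻¹} =
        (Subgroup.centralizer {a}).map (MulAut.conj x).toMonoidHom := by
      ext y
      rw [Subgroup.mem_map]
      constructor
      · intro hy
        refine ⟨x⁻¹ * y * x, ?_, by simp [mul_assoc]⟩
        rw [Subgroup.mem_centralizer_singleton_iff] at hy ⊢
        calc x⁻¹ * y * x * a = x⁻¹ * (y * (x * a * x⁻¹)) * x := by group
          _ = a * (x⁻¹ * y * x) := by rw [hy]; group
      · rintro ⟨z, hz, rfl⟩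
        rw [Subgroup.mem_centralizer_singleton_iff] at hz ⊢
        simp only [MulEquiv.toMonoidHom_eq_coe, MonoidHom.coe_coe, MulAut.conj_apply]
        calc x * z * x⁻¹ * (x * a * x⁻¹) = x * (z * a) * x⁻¹ := by group
          _ = _ := by rw [hz]; group
    rw [h]
    exact ⟨(Subgroup.index_map_equiv _ (MulAut.conj x)).trans_ne ha.index_ne_zero⟩

lemma pow_mem_centralizer {g : G} (hg : g ∈ fcCenter G) (x : G) :
    ∃ n, 0 < n ∧ x ^ n ∈ Subgroup.centralizer {g} := by
  obtain ⟨n, hn, -, h⟩ := Subgroup.exists_pow_mem_of_index_ne_zero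
    (mem_fcCenter.1 hg).index_ne_zero x
  exact ⟨n, hn, h⟩

/-- A finitely generated group whose elements have finitely many conjugates has finite commutator
subgroup. -/
lemma finite_commutator_of_fcCenter_eq_top (h : fcCenter G = ⊤) [hG : Group.FG G] :
    Finite (commutator G) := by
  obtain ⟨S, hS⟩ := Group.fg_def.1 hG
  have hfin : (Subgroup.center G).FiniteIndex := by
    rw [Subgroup.center_eq_iInf hS]
    exact Subgroup.finiteIndex_iInf' _ fun g _ => by
      have : g ∈ fcCenter G := h ▸ Subgroup.mem_top g
      exact this
  -- The centre has finite index, being an intersection of finitely many centralisers. Commutators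
  -- depend only on cosets of it, so they are finite in number, and the group they generate is
  -- finite (Schur).
  have : Finite (commutatorSet G) := by
    let f : (G ⧸ Subgroup.center G) × (G ⧸ Subgroup.center G) → G := fun p => ⁅p.1.out, p.2.out⁆
    refine (Set.Finite.subset (Set.finite_range f) ?_).to_subtype
    rintro _ ⟨x, y, rfl⟩
    refine ⟨(x, y), ?_⟩
    obtain ⟨a, ha⟩ := QuotientGroup.mk_out_eq_mul (Subgroup.center G) x
    obtain ⟨b, hb⟩ := QuotientGroup.mk_out_eq_mul (Subgroup.center G) y
    have h1 := fun z => Subgroup.mem_center_iff.1 a.2 z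
    have h2 := fun z => Subgroup.mem_center_iff.1 b.2 z
    simp only [f, ha, hb, commutatorElement_def, mul_inv_rev]
    calc x * (a : G) * (y * b) * ((a : G)⁻¹ * x⁻¹) * ((b : G)⁻¹ * y⁻¹)
        = x * ((a : G) * (y * b)) * (a : G)⁻¹ * x⁻¹ * (b : G)⁻¹ * y⁻¹ := by group
      _ = x * (y * (b * x⁻¹)) * (b : G)⁻¹ * y⁻¹ := by rw [← h1]; group
      _ = x * y * x⁻¹ * y⁻¹ := by rw [← h2]; group
  infer_instance

lemma fcCenter_eq_top_of_le {H : Subgroup G} (hH : H ≤ fcCenter G) : fcCenter H = ⊤ := by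
  rw [eq_top_iff]
  rintro ⟨x, hx⟩ -
  have : (Subgroup.centralizer {x}).FiniteIndex := hH hx
  rw [mem_fcCenter]
  refine Subgroup.finiteIndex_of_le (H := (Subgroup.centralizer {x}).subgroupOf H) fun y hy => ?_
  rw [Subgroup.mem_subgroupOf, Subgroup.mem_centralizer_singleton_iff] at hy
  rw [Subgroup.mem_centralizer_singleton_iff]
  exact Subtype.ext hy

/-- Dietzmann's lemma: an element of finite order with finitely many conjugates lies in a finite
normal subgroup. -/
lemma finite_normalClosure {g : G} (hg : g ∈ fcCenter G) (ho : IsOfFinOrder g) :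
    Finite (Subgroup.normalClosure {g}) := by
  set N := Subgroup.normalClosure {g} with hN
  have hS : (Group.conjugatesOfSet {g}).Finite := by
    have : (Subgroup.centralizer {g}).FiniteIndex := hg
    let f : G ⧸ Subgroup.centralizer {g} → G := fun x => x.out * g * x.out⁻¹
    refine Set.Finite.subset (Set.finite_range f) fun y hy => ?_
    obtain ⟨a, ha, hy'⟩ := Group.mem_conjugatesOfSet_iff.1 hy
    rw [Set.mem_singleton_iff] at ha; subst ha
    obtain ⟨c, rfl⟩ := isConj_iff.1 hy'
    obtain ⟨z, hz⟩ := QuotientGroup.mk_out_eq_mul (Subgroup.centralizer {a}) c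
    refine ⟨c, ?_⟩
    have := Subgroup.mem_centralizer_singleton_iff.1 z.2
    simp only [f, hz]
    calc c * (z : G) * a * (c * z)⁻¹ = c * (z * a) * (c * z)⁻¹ := by group
      _ = c * a * c⁻¹ := by rw [this]; group
  have hle : N ≤ fcCenter G := Subgroup.normalClosure_le_normal (by simpa using hg)
  have hFG : Group.FG N := by
    rw [Group.fg_iff_subgroup_fg]
    exact ⟨hS.toFinset, by rw [hS.coe_toFinset]; rfl⟩
  have := finite_commutator_of_fcCenter_eq_top (fcCenter_eq_top_of_le hle)
  -- The abelianisation is finitely generated by the finitely many torsion conjugates of g, hence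
  -- finite.
  have hQ : Finite (N ⧸ commutator N) := by
    change Finite (Abelianization N)
    have : Group.FG (Abelianization N) :=
      Group.fg_of_surjective (f := Abelianization.of) QuotientGroup.mk_surjective
    refine CommGroup.finite_of_fg_isMulTorsion _ fun a => ?_
    obtain ⟨⟨n, hn⟩, rfl⟩ := QuotientGroup.mk_surjective a
    induction hn using Subgroup.closure_induction with
    | mem x hx =>
      refine MonoidHom.isOfFinOrder (Abelianization.of (G := N)) ?_
      rw [← Submonoid.isOfFinOrder_coe (H := N.toSubmonoid)]
      obtain ⟨b, hb, hx'⟩ := Group.mem_conjugatesOfSet_iff.1 hx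
      rw [Set.mem_singleton_iff] at hb; subst hb
      obtain ⟨c, rfl⟩ := isConj_iff.1 hx'
      exact (MulAut.conj c).toMonoidHom.isOfFinOrder ho
    | one => exact IsOfFinOrder.one
    | mul x y hx hy h1 h2 => exact IsOfFinOrder.mul h1 h2
    | inv x hx h1 => exact IsOfFinOrder.inv h1
  exact Finite.of_subgroup_quotient (commutator N)

/-- Two elements of the FC-centre with a common power differ by an element of finite order. -/
lemma isOfFinOrder_inv_mul {x y : G} (hx : x ∈ fcCenter G) (hy : y ∈ fcCenter G) {n : ℕ}
    (hn : 0 < n) (h : x ^ n = y ^ n) : IsOfFinOrder (x⁻¹ * y) := by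
  set H := Subgroup.closure {x, y}
  have hle : H ≤ fcCenter G := by
    rw [Subgroup.closure_le]; rintro z (rfl | rfl) <;> assumption
  have hFG : Group.FG H := by
    rw [Group.fg_iff_subgroup_fg]; classical exact ⟨({x, y} : Finset G), by simp [H]⟩
  have := finite_commutator_of_fcCenter_eq_top (fcCenter_eq_top_of_le hle)
  have hxH : x ∈ H := Subgroup.subset_closure (by simp)
  have hyH : y ∈ H := Subgroup.subset_closure (by simp)
  let x' : H := ⟨x, hxH⟩
  let y' : H := ⟨y, hyH⟩
  have h' : x' ^ n = y' ^ n := Subtype.ext h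
  -- The n-th power dies in the abelianisation of ⟨x, y⟩, whose commutator subgroup is finite.
  have hmem : (x'⁻¹ * y') ^ n ∈ commutator H := by
    have : Abelianization.of ((x'⁻¹ * y') ^ n) = 1 := by
      rw [map_pow, map_mul, mul_pow, map_inv, inv_pow, ← map_pow, ← map_pow, h', inv_mul_cancel]
    exact (QuotientGroup.eq_one_iff _).1 this
  have h1 : IsOfFinOrder (⟨_, hmem⟩ : commutator H) := isOfFinOrder_of_finite _
  have h2 : IsOfFinOrder ((x'⁻¹ * y') ^ n) := (Submonoid.isOfFinOrder_coe).2 h1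
  have h3 : IsOfFinOrder (x'⁻¹ * y') := h2.of_pow hn.ne'
  exact (Submonoid.isOfFinOrder_coe (H := H.toSubmonoid)).2 h3

/-- Finitely many conjugacy conditions on elements outside the FC-centre, and finitely many cosets
of the FC-centre when it has infinite index, can be avoided simultaneously. -/
lemma exists_conj_ne (s : Finset (G × G)) (hs : ∀ p ∈ s, p.1 ∉ fcCenter G) (D : Finset G)
    (hD : D.Nonempty → ¬ (fcCenter G).FiniteIndex) :
    ∃ x : G, (∀ p ∈ s, x⁻¹ * p.1 * x ≠ p.2) ∧ ∀ d ∈ D, d⁻¹ * x ∉ fcCenter G := by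
  classical
  by_contra! hcon
  let t := s.filter fun p => ∃ x : G, x⁻¹ * p.1 * x = p.2
  have ht : ∀ p ∈ t, ∃ x : G, x⁻¹ * p.1 * x = p.2 := fun p hp => (Finset.mem_filter.1 hp).2
  choose! c hc using ht
  let K : (G × G) ⊕ G → Subgroup G := Sum.elim (fun p => Subgroup.centralizer {p.2})
    fun _ => fcCenter G
  -- B. H. Neumann's covering lemma: the x that carry p.1 to p.2 form a left coset of the
  -- centraliser of p.2, which has infinite index because p.1, and so p.2, is outside the FC-centre.
  obtain ⟨k, hk, hfi⟩ := Subgroup.exists_finiteIndex_of_leftCoset_cover (H := K)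
    (g := Sum.elim c id) (s := t.disjSum D) (by
      rw [Set.eq_univ_iff_forall]
      intro x
      rw [Set.mem_iUnion₂]
      by_cases hx : ∀ p ∈ s, x⁻¹ * p.1 * x ≠ p.2
      · obtain ⟨d, hd, hdx⟩ := hcon x hx
        exact ⟨Sum.inr d, by simpa using hd, by
          rw [mem_leftCoset_iff]; exact hdx⟩
      · push Not at hx
        obtain ⟨p, hp, hpx⟩ := hx
        have hpt : p ∈ t := Finset.mem_filter.2 ⟨hp, x, hpx⟩
        refine ⟨Sum.inl p, by simpa using hpt, ?_⟩
        rw [mem_leftCoset_iff]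
        simp only [Sum.elim_inl, K, SetLike.mem_coe]
        rw [Subgroup.mem_centralizer_singleton_iff]
        have h1 := hc p hpt
        calc (c p)⁻¹ * x * p.2 = (c p)⁻¹ * p.1 * x := by rw [← hpx]; group
          _ = p.2 * ((c p)⁻¹ * x) := by rw [← h1]; group)
  rcases k with p | d
  · have hpt : p ∈ t := by simpa using hk
    have h1 := hc p hpt
    have h2 : p.2 ∈ fcCenter G := hfi
    refine hs p (Finset.mem_filter.1 hpt).1 ?_
    have h3 : p.1 = c p * p.2 * (c p)⁻¹ := by rw [← h1]; group
    rw [h3]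
    exact (inferInstance : (fcCenter G).Normal).conj_mem _ h2 _
  · have hd : d ∈ D := by simpa using hk
    exact hD ⟨d, hd⟩ hfi

end FCCenter

/-! ### Quaternion subgroups of Hamiltonian torsion groups. -/

section Dedekind

variable {G : Type*} [Group G]

lemma pow_mul_eq_of_mul_eq {a b c : G} (h : a * b = c * (b * a)) (hca : Commute c a) (n : ℕ) :
    a ^ n * b = c ^ n * (b * a ^ n) := by
  induction n with
  | zero => simp
  | succ n ih =>
    rw [pow_succ', mul_assoc, ih, ← mul_assoc, (hca.symm.pow_right n).eq, mul_assoc,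
      ← mul_assoc a, h, pow_succ]
    simp only [mul_assoc]

lemma mul_pow_of_mul_eq {a b c : G} (h : a * b = c * (b * a)) (hca : Commute c a)
    (hcb : Commute c b) (n : ℕ) : (b * a) ^ n = b ^ n * a ^ n * c ^ n.choose 2 := by
  induction n with
  | zero => simp
  | succ n ih =>
    have h1 := pow_mul_eq_of_mul_eq h hca n
    have hcc : Commute (c ^ n.choose 2) (b * a) := (hcb.mul_right hca).pow_left _
    have hcn : Commute (c ^ n) (b * a ^ n * a) :=
      ((hcb.mul_right (hca.pow_right n)).mul_right hca).pow_left _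
    have hch : (n + 1).choose 2 = n + n.choose 2 := by
      rw [Nat.choose_succ_succ, Nat.choose_one_right]
    calc (b * a) ^ (n + 1) = b ^ n * a ^ n * (c ^ n.choose 2 * (b * a)) := by
          rw [pow_succ, ih, mul_assoc]
      _ = b ^ n * (a ^ n * b) * a * c ^ n.choose 2 := by rw [hcc.eq]; simp only [mul_assoc]
      _ = b ^ n * (c ^ n * (b * a ^ n * a)) * c ^ n.choose 2 := by
          rw [h1]; simp only [mul_assoc]
      _ = b ^ (n + 1) * a ^ (n + 1) * c ^ (n + 1).choose 2 := by
          rw [hcn.eq, hch, pow_add c, pow_succ b, pow_succ a]; simp only [mul_assoc]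

/-- The commutator c lies in ⟨a⟩ ∩ ⟨b⟩, so it commutes with a and b. Minimality of the pair makes c
of prime order q and the orders of a and b the powers qᵐ⁺¹ and qⁿ⁺¹. Both cyclic groups have ⟨c⟩ as
their subgroup of order q, so b^(qⁿ) = a^(s qⁿ) for some s. Replacing b by b a⁻ˢ must not lower its
order, and this leaves only q = 2 and m = n = 1. -/
lemma exists_quaternion_aux {a b : G} (hn : ∀ g : G, (Subgroup.zpowers g).Normal)
    (ht : ∀ g : G, IsOfFinOrder g) (hab : a * b ≠ b * a)
    (hmin : ∀ a' b' : G, orderOf a' * orderOf b' < orderOf a * orderOf b → a' * b' = b' * a')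
    (hle : orderOf b ≤ orderOf a) :
    a ^ 4 = 1 ∧ a ^ 2 = b ^ 2 ∧ a * b * a⁻¹ = b⁻¹ := by
  have ha0 : 0 < orderOf a := (ht a).orderOf_pos
  have hb0 : 0 < orderOf b := (ht b).orderOf_pos
  set c := a * b * a⁻¹ * b⁻¹ with hc
  have hcomm : a * b = c * (b * a) := by rw [hc]; group
  have hca' : c ∈ Subgroup.zpowers a := by
    rw [hc, mul_assoc, mul_assoc]
    refine mul_mem (Subgroup.mem_zpowers a) ?_
    rw [← mul_assoc]
    exact (hn a).conj_mem _ (inv_mem (Subgroup.mem_zpowers a)) b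
  have hcb' : c ∈ Subgroup.zpowers b :=
    mul_mem ((hn b).conj_mem _ (Subgroup.mem_zpowers b) a) (inv_mem (Subgroup.mem_zpowers b))
  have hca : Commute c a := by
    obtain ⟨k, hk⟩ := hca'; rw [← hk]; exact Commute.zpow_self a k
  have hcb : Commute c b := by
    obtain ⟨k, hk⟩ := hcb'; rw [← hk]; exact Commute.zpow_self b k
  have hc1 : c ≠ 1 := fun h => hab (by rw [hcomm, h, one_mul])
  have hord : ∀ {x : G} {r : ℕ}, 0 < orderOf x → r.Prime → r ∣ orderOf x →
      orderOf (x ^ r) < orderOf x := fun hx hr hd => by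
    rw [orderOf_pow_of_dvd hr.ne_zero hd]
    exact Nat.div_lt_self hx hr.one_lt
  have hpa : ∀ r : ℕ, r.Prime → r ∣ orderOf a → c ^ r = 1 := by
    intro r hr hd
    have h1 := hmin (a ^ r) b (Nat.mul_lt_mul_of_pos_right (hord ha0 hr hd) hb0)
    rw [pow_mul_eq_of_mul_eq hcomm hca] at h1
    simpa using h1
  have hcomm' : b * a = c⁻¹ * (a * b) := by rw [hcomm]; group
  have hpb : ∀ r : ℕ, r.Prime → r ∣ orderOf b → c ^ r = 1 := by
    intro r hr hd
    have h1 := hmin a (b ^ r) (Nat.mul_lt_mul_of_pos_left (hord hb0 hr hd) ha0)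
    rw [pow_mul_eq_of_mul_eq hcomm' hcb.inv_left] at h1
    simpa using h1.symm
  have ha1 : orderOf a ≠ 1 := fun h => hab (by rw [orderOf_eq_one_iff.1 h]; simp)
  have hb1 : orderOf b ≠ 1 := fun h => hab (by rw [orderOf_eq_one_iff.1 h]; simp)
  obtain ⟨q, hq, hqa⟩ := Nat.exists_prime_and_dvd ha1
  have hqc : orderOf c = q := orderOf_eq_prime (hpa q hq hqa) hc1 (hp := ⟨hq⟩)
  have hprime : ∀ r : ℕ, r.Prime → c ^ r = 1 → r = q := fun r hr h =>
    ((Nat.prime_dvd_prime_iff_eq hq hr).1 (hqc ▸ orderOf_dvd_of_pow_eq_one h)).symm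
  obtain ⟨m, hm⟩ : ∃ m, orderOf a = q ^ m := ⟨_, Nat.eq_prime_pow_of_unique_prime_dvd ha0.ne'
    fun {r} hr hd => hprime r hr (hpa r hr hd)⟩
  obtain ⟨n, hn'⟩ : ∃ n, orderOf b = q ^ n := ⟨_, Nat.eq_prime_pow_of_unique_prime_dvd hb0.ne'
    fun {r} hr hd => hprime r hr (hpb r hr hd)⟩
  obtain ⟨m, rfl⟩ : ∃ k, m = k + 1 := Nat.exists_eq_succ_of_ne_zero fun h => ha1 (by simp [hm, h])
  obtain ⟨n, rfl⟩ : ∃ k, n = k + 1 := Nat.exists_eq_succ_of_ne_zero fun h => hb1 (by simp [hn', h])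
  have hnm : n ≤ m := by
    rw [hm, hn'] at hle
    have := (Nat.pow_le_pow_iff_right hq.one_lt).1 hle
    omega
  have hcpow : c ^ q = 1 := by rw [← hqc]; exact pow_orderOf_eq_one c
  -- the elements of order `q` of the two cyclic groups generate the same subgroup
  have hroot : ∀ {x : G} {k : ℕ}, orderOf x = q ^ (k + 1) → c ∈ Subgroup.zpowers x →
      Subgroup.zpowers (x ^ q ^ k) = Subgroup.zpowers c := by
    intro x k hx hcx
    have hxo : orderOf (x ^ q ^ k) = q := by
      rw [orderOf_pow_of_dvd (pow_ne_zero _ hq.ne_zero) (hx ▸ pow_dvd_pow q (Nat.le_succ k)), hx,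
        pow_succ, Nat.mul_div_cancel_left _ (pow_pos hq.pos k)]
    have hx0 : IsOfFinOrder x := ht x
    obtain ⟨j, hj⟩ := (hx0.mem_powers_iff_mem_zpowers).2 hcx
    have hj : x ^ j = c := hj
    have h1 : q ^ k ∣ j := by
      refine Nat.dvd_of_mul_dvd_mul_right hq.pos ?_
      rw [← pow_succ, ← hx]
      apply orderOf_dvd_of_pow_eq_one
      rw [pow_mul, hj, hcpow]
    obtain ⟨i, rfl⟩ := h1
    have hle : Subgroup.zpowers c ≤ Subgroup.zpowers (x ^ q ^ k) := by
      rw [Subgroup.zpowers_le, ← hj, pow_mul]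
      exact pow_mem (Subgroup.mem_zpowers _) _
    have : Finite (Subgroup.zpowers (x ^ q ^ k)) := finite_zpowers.2 (ht _)
    exact (Subgroup.eq_of_le_of_card_ge hle (by rw [Nat.card_zpowers, Nat.card_zpowers, hxo, hqc])).symm
  have hva := hroot hm hca'
  have hvb := hroot hn' hcb'
  have hb_mem : b ^ q ^ n ∈ Subgroup.zpowers (a ^ q ^ m) := by
    rw [hva, ← hvb]; exact Subgroup.mem_zpowers _
  obtain ⟨i, hi⟩ := ((ht _).mem_powers_iff_mem_zpowers).2 hb_mem
  obtain ⟨s, hs⟩ : ∃ s, s = i * q ^ (m - n) := ⟨_, rfl⟩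
  have hi' : a ^ (s * q ^ n) = b ^ q ^ n := by
    rw [← hi]
    change _ = (a ^ q ^ m) ^ i
    rw [hs, ← pow_mul, mul_assoc, ← pow_add, Nat.sub_add_cancel hnm, mul_comm]
  have hy : (a ^ s)⁻¹ * b = (c ^ s)⁻¹ * (b * (a ^ s)⁻¹) := by
    have h1 := pow_mul_eq_of_mul_eq hcomm hca s
    have h2 : Commute (c ^ s) (a ^ s) := hca.pow_pow s s
    have h3 : Commute (c ^ s) ((a ^ s)⁻¹ * b) := h2.inv_right.mul_right (hcb.pow_left s)
    have h4 : c ^ s * ((a ^ s)⁻¹ * b) = b * (a ^ s)⁻¹ := by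
      rw [h3.eq, mul_assoc, ← (hcb.pow_left s).eq, inv_mul_eq_iff_eq_mul, eq_comm, ← mul_assoc, h1,
        ← mul_assoc, mul_inv_cancel_right]
    rw [← h4, inv_mul_cancel_left]
  have hN := mul_pow_of_mul_eq hy
    ((hca.pow_pow s s).inv_inv) ((hcb.pow_left s).inv_left) (q ^ n)
  rw [inv_pow, ← pow_mul, hi', mul_inv_cancel, one_mul, inv_pow, ← pow_mul] at hN
  -- The qⁿ-th power of b a⁻ˢ is c to the power −s · C(qⁿ, 2). Were it trivial, b a⁻ˢ would have
  -- smaller order than b, so would commute with a, and b would too.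
  have hndvd : ¬ q ∣ s * (q ^ n).choose 2 := by
    rintro ⟨k, hk⟩
    rw [hk, pow_mul, hcpow, one_pow, inv_one] at hN
    have h1 : orderOf (b * (a ^ s)⁻¹) < orderOf b := by
      refine (Nat.le_of_dvd (pow_pos hq.pos n) (orderOf_dvd_of_pow_eq_one hN)).trans_lt ?_
      rw [hn']
      exact Nat.pow_lt_pow_right hq.one_lt (Nat.lt_succ_self n)
    have h2 := hmin a _ (Nat.mul_lt_mul_of_pos_left h1 ha0)
    have h3 : Commute a (b * (a ^ s)⁻¹) := h2
    have h4 : Commute a (b * (a ^ s)⁻¹ * a ^ s) := h3.mul_right (Commute.self_pow a s)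
    rw [inv_mul_cancel_right] at h4
    exact hab h4.eq
  have hch : (q ^ n).choose 2 * 2 = q ^ n * (q ^ n - 1) := by
    rw [Nat.choose_two_right, Nat.div_mul_cancel (Nat.even_mul_pred_self _).two_dvd]
  have hn0 : n ≠ 0 := by
    rintro rfl
    exact hndvd (by simp)
  have hq2 : q = 2 := by
    by_contra hne
    have h1 : q ∣ (q ^ n).choose 2 * 2 := by
      rw [hch]; exact Dvd.dvd.mul_right (dvd_pow_self q hn0) _
    have h2 : Nat.Coprime q 2 := (Nat.coprime_primes hq Nat.prime_two).2 hne
    exact hndvd (Dvd.dvd.mul_left (h2.dvd_of_dvd_mul_right h1) _)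
  subst hq2
  have hn1 : n = 1 := by
    by_contra hne
    obtain ⟨k, rfl⟩ : ∃ k, n = k + 2 := ⟨n - 2, by omega⟩
    have h1 : (2 ^ (k + 2)).choose 2 = 2 * (2 ^ k * (2 ^ (k + 2) - 1)) := by
      have : (2 ^ (k + 2)).choose 2 * 2 = 2 * (2 ^ k * (2 ^ (k + 2) - 1)) * 2 := by
        rw [hch]; ring
      exact Nat.eq_of_mul_eq_mul_right two_pos this
    exact hndvd (Dvd.dvd.mul_left ⟨_, h1⟩ _)
  subst hn1
  have hs2 : ¬ 2 ∣ s := fun h => hndvd (Dvd.dvd.mul_right h _)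
  have hm1 : m = 1 := by
    by_contra hne
    have : m - 1 ≠ 0 := by omega
    exact hs2 (hs ▸ Dvd.dvd.mul_left (dvd_pow_self 2 this) _)
  subst hm1
  have ha4 : a ^ 4 = 1 := by
    rw [← orderOf_dvd_iff_pow_eq_one, hm]; norm_num
  have hb4 : b ^ 4 = 1 := by
    rw [← orderOf_dvd_iff_pow_eq_one, hn']; norm_num
  have hb22 : (b ^ 2) ^ 2 = 1 := by rw [← pow_mul]; exact hb4
  refine ⟨ha4, ?_, ?_⟩
  · obtain ⟨k, hk⟩ : ∃ k, s = 2 * k + 1 := ⟨s / 2, by omega⟩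
    have : s * 2 ^ 1 = 4 * k + 2 := by omega
    rw [this, pow_add, pow_mul, ha4, one_pow, one_mul] at hi'
    simpa using hi'
  · have h1 : c ∈ Subgroup.zpowers (b ^ 2 ^ 1) := by rw [hvb]; exact Subgroup.mem_zpowers c
    obtain ⟨j, hj⟩ := ((ht _).mem_powers_iff_mem_zpowers).2 h1
    have hj : (b ^ 2) ^ j = c := by simpa using hj
    have h2 : c = b ^ 2 := by
      rcases Nat.even_or_odd' j with ⟨k, rfl | rfl⟩
      · rw [pow_mul, hb22, one_pow] at hj
        exact absurd hj.symm hc1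
      · rw [pow_succ, pow_mul, hb22, one_pow, one_mul] at hj
        exact hj.symm
    have h3 : a * b * a⁻¹ = c * b := by rw [hc]; group
    rw [h3, h2, eq_inv_iff_mul_eq_one, ← hb4]
    group

/-- A nonabelian torsion group in which all cyclic subgroups are normal contains the quaternion
group of order eight. -/
theorem exists_quaternion (hn : ∀ g : G, (Subgroup.zpowers g).Normal)
    (ht : ∀ g : G, IsOfFinOrder g) (hG : ¬ ∀ a b : G, a * b = b * a) :
    ∃ a b : G, a * b ≠ b * a ∧ a ^ 4 = 1 ∧ a ^ 2 = b ^ 2 ∧ a * b * a⁻¹ = b⁻¹ := by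
  classical
  have hex : ∃ n, ∃ a b : G, a * b ≠ b * a ∧ orderOf a * orderOf b = n := by
    push Not at hG
    obtain ⟨a, b, h⟩ := hG
    exact ⟨_, a, b, h, rfl⟩
  obtain ⟨a, b, hab, ho⟩ := Nat.find_spec hex
  have hmin : ∀ a' b' : G, orderOf a' * orderOf b' < orderOf a * orderOf b → a' * b' = b' * a' := by
    intro a' b' h
    by_contra hne
    rw [ho] at h
    exact Nat.find_min hex h ⟨a', b', hne, rfl⟩
  rcases le_total (orderOf b) (orderOf a) with h | h
  · exact ⟨a, b, hab, exists_quaternion_aux hn ht hab hmin h⟩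
  · exact ⟨b, a, hab.symm, exists_quaternion_aux hn ht hab.symm
      (fun a' b' h' => hmin a' b' (by rwa [mul_comm (orderOf a)])) h⟩

end Dedekind

/-! ### The involution of the group algebra and sums over finite subgroups. -/

section GroupAlgebra

open MonoidAlgebra

variable {F G : Type*} [Field F] [Group G]

lemma invol_of (g : G) : invol (of F G g) = of F G g⁻¹ := by
  simp [invol]

/-- Linear functions on the group algebra are determined by their values on group elements. -/
lemma induction_of {P : MonoidAlgebra F G → Prop} (x : MonoidAlgebra F G) (_zero : P 0)
    (of_mem : ∀ g, P (of F G g)) (add : ∀ x y, P x → P y → P (x + y))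
    (smul : ∀ (c : F) x, P x → P (c • x)) : P x := by
  induction x using MonoidAlgebra.induction_on with
  | of g => exact of_mem g
  | add x y hx hy => exact add x y hx hy
  | smul c x hx => exact smul c x hx

lemma invol_add (x y : MonoidAlgebra F G) : invol (x + y) = invol x + invol y :=
  MonoidAlgebra.mapDomain_add _ x y

lemma invol_smul (c : F) (x : MonoidAlgebra F G) : invol (c • x) = c • invol x := by
  ext g
  simp [invol]

lemma invol_mul (x y : MonoidAlgebra F G) : invol (x * y) = invol y * invol x := by
  have h0 : invol (0 : MonoidAlgebra F G) = 0 := MonoidAlgebra.mapDomain_zero _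
  induction x using induction_of with
  | _zero => simp [h0]
  | of_mem g =>
    induction y using induction_of with
    | _zero => simp [h0]
    | of_mem h => rw [← map_mul, invol_of, invol_of, invol_of, ← map_mul, mul_inv_rev]
    | add x y hx hy => rw [mul_add, invol_add, hx, hy, invol_add, add_mul]
    | smul c x hx => rw [mul_smul_comm, invol_smul, hx, invol_smul, smul_mul_assoc]
  | add x z hx hz => rw [add_mul, invol_add, hx, hz, invol_add, mul_add]
  | smul c x hx => rw [smul_mul_assoc, invol_smul, hx, invol_smul, mul_smul_comm]

noncomputable instance : StarRing (MonoidAlgebra F G) where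
  star := invol
  star_involutive x := by
    ext g
    simp [invol, Finsupp.mapDomain_comp.symm]
  star_add := invol_add
  star_mul := invol_mul

lemma star_of (g : G) : star (of F G g) = of F G g⁻¹ := invol_of g

lemma star_smul_monoidAlgebra (c : F) (x : MonoidAlgebra F G) : star (c • x) = c • star x :=
  invol_smul c x

lemma coeff_star (x : MonoidAlgebra F G) (g : G) : (star x).coeff g = x.coeff g⁻¹ := by
  have := Finsupp.mapDomain_apply (inv_injective (G := G)) x.coeff g⁻¹
  rwa [inv_inv] at this

lemma coeff_of_mul (g : G) (x : MonoidAlgebra F G) (h : G) :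
    (of F G g * x).coeff h = x.coeff (g⁻¹ * h) := by
  simp

lemma coeff_mul_of (x : MonoidAlgebra F G) (g h : G) :
    (x * of F G g).coeff h = x.coeff (h * g⁻¹) := by
  simp

lemma commute_of_forall_of {a : MonoidAlgebra F G} (h : ∀ g, Commute (of F G g) a)
    (x : MonoidAlgebra F G) : Commute x a := by
  induction x using induction_of with
  | _zero => exact Commute.zero_left a
  | of_mem g => exact h g
  | add x y hx hy => exact hx.add_left hy
  | smul c x hx => exact hx.smul_left c

/-- The sum in the group algebra of the elements of a finite subgroup. -/
noncomputable def hat (F : Type*) [Field F] (A : Subgroup G) [Fintype A] : MonoidAlgebra F G :=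
  ∑ a : A, of F G (a : G)

section Hat

variable (A : Subgroup G) [Fintype A]

open Classical in
lemma coeff_hat (x : G) : (hat F A).coeff x = if x ∈ A then 1 else 0 := by
  simp only [hat, coeff_sum, Finsupp.finsetSum_apply, of_apply, coeff_single,
    Finsupp.single_apply]
  split_ifs with h
  · rw [Finset.sum_eq_single ⟨x, h⟩ (fun b _ hb => if_neg fun h' => hb (Subtype.ext h'))
      (fun h' => absurd (Finset.mem_univ _) h')]
    simp
  · exact Finset.sum_eq_zero fun a _ => if_neg (by rintro rfl; exact h a.2)

lemma coeff_hat_of_mem {x : G} (h : x ∈ A) : (hat F A).coeff x = 1 := by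
  rw [coeff_hat, if_pos h]

lemma hat_ne_zero : hat F A ≠ 0 := fun h => by
  have := coeff_hat_of_mem (F := F) A A.one_mem
  rw [h] at this
  exact zero_ne_one this

lemma star_hat : star (hat F A) = hat F A := by
  classical
  ext x
  simp only [coeff_star, coeff_hat, inv_mem_iff]

variable {A} in
lemma of_mul_hat {a : G} (ha : a ∈ A) : of F G a * hat F A = hat F A := by
  classical
  ext x
  simp only [coeff_of_mul, coeff_hat, A.mul_mem_cancel_left (inv_mem ha)]

lemma hat_mul_hat : hat F A * hat F A = (Nat.card A : F) • hat F A := by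
  nth_rewrite 1 [hat]
  rw [Finset.sum_mul, Finset.sum_congr rfl fun a _ => of_mul_hat a.2, Finset.sum_const,
    Finset.card_univ, Nat.card_eq_fintype_card, Nat.cast_smul_eq_nsmul]

lemma commute_of_hat_iff {x : G} : Commute (of F G x) (hat F A) ↔ ∀ a, a ∈ A ↔ x * a * x⁻¹ ∈ A := by
  classical
  constructor
  · intro h a
    have h1 := congrArg (fun y => y.coeff (x * a)) h.eq
    simp only [coeff_of_mul, coeff_mul_of, inv_mul_cancel_left, coeff_hat] at h1
    by_cases h2 : a ∈ A <;> by_cases h3 : x * a * x⁻¹ ∈ A <;> simp_all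
  · intro h
    ext y
    simp only [coeff_of_mul, coeff_mul_of, coeff_hat, h (x⁻¹ * y)]
    simp

end Hat

namespace SymmetricIdentity

variable {w : FreeGroup ℕ} (H : SymmetricIdentity F (MonoidAlgebra F G) w)
include H

/-- For normal A the element Â is central with Â² = |A|Â, so |A| = 0 in F would contradict
semiprimeness. -/
lemma card_ne_zero_of_normal (A : Subgroup G) [Fintype A] [A.Normal] : (Nat.card A : F) ≠ 0 := by
  intro h0
  refine hat_ne_zero (F := F) A (H.semiprime _ fun r => ?_)
  have hc : Commute r (hat F A) := commute_of_forall_of (fun g => (commute_of_hat_iff A).2 fun a =>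
    ⟨fun h => ‹A.Normal›.conj_mem a h g, fun h => by
      simpa [mul_assoc] using ‹A.Normal›.conj_mem _ h g⁻¹⟩) r
  rw [← hc.eq, mul_assoc, hat_mul_hat, h0, zero_smul, mul_zero]

/-- The symmetric idempotent |A|⁻¹Â is central, and a group element commutes with Â only if it
normalises A. -/
lemma normal_of_card_ne_zero (A : Subgroup G) [Fintype A] (hA : (Nat.card A : F) ≠ 0) :
    A.Normal := by
  have h1 : IsIdempotentElem ((Nat.card A : F)⁻¹ • hat F A) := by
    rw [IsIdempotentElem, smul_mul_smul_comm, hat_mul_hat, smul_smul, mul_assoc,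
      inv_mul_cancel₀ hA, mul_one]
  have h2 : star ((Nat.card A : F)⁻¹ • hat F A) = (Nat.card A : F)⁻¹ • hat F A := by
    rw [H.star_smul, star_hat]
  refine ⟨fun a ha g => ?_⟩
  have h3 := (H.commute_of_isIdempotentElem h1 h2 (of F G g)).smul_left (Nat.card A : F)
  rw [smul_smul, mul_inv_cancel₀ hA, one_smul] at h3
  exact ((commute_of_hat_iff A).1 h3.symm a).1 ha

lemma isOfFinOrder_natCast_orderOf_ne_zero {g : G} (hg : g ∈ fcCenter G) (ho : IsOfFinOrder g) :
    (orderOf g : F) ≠ 0 := by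
  have := finite_normalClosure hg ho
  have := Fintype.ofFinite (Subgroup.normalClosure {g})
  have h1 := H.card_ne_zero_of_normal (Subgroup.normalClosure {g})
  have h2 : orderOf g ∣ Nat.card (Subgroup.normalClosure {g}) :=
    Subgroup.orderOf_dvd_natCard _ (Subgroup.subset_normalClosure rfl)
  intro h
  obtain ⟨k, hk⟩ := h2
  exact h1 (by rw [hk, Nat.cast_mul, h, zero_mul])

end SymmetricIdentity

end GroupAlgebra

/-- Multiplication by d permutes the values of f; compare the products of all values. -/
lemma pow_card_eq_one_of_injective {ι U : Type*} [Fintype ι] [CommGroup U] {f : ι → U}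
    (hf : Function.Injective f) {d : U} (h : ∀ i, ∃ j, f j = d * f i) : d ^ Fintype.card ι = 1 := by
  choose σ hσ using h
  have hinj : Function.Injective σ := fun i j hij => hf (mul_left_cancel (a := d) (by
    rw [← hσ, ← hσ, hij]))
  have h1 : ∏ i, f (σ i) = ∏ i, f i :=
    Fintype.prod_bijective σ (Finite.injective_iff_bijective.1 hinj) _ _ fun _ => rfl
  simp only [hσ, Finset.prod_mul_distrib, Finset.prod_const, Finset.card_univ] at h1
  exact mul_eq_right.1 h1

lemma sum_pow_char_of_commute {R ι : Type*} [Semiring R] (p : ℕ) [Fact p.Prime] [CharP R p]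
    (s : Finset ι) (f : ι → R) (h : ∀ i j, Commute (f i) (f j)) :
    (∑ i ∈ s, f i) ^ p = ∑ i ∈ s, f i ^ p := by
  classical
  induction s using Finset.induction_on with
  | empty => simp [(Fact.out : p.Prime).ne_zero]
  | insert i s hi ih =>
    rw [Finset.sum_insert hi, Finset.sum_insert hi, ← ih]
    exact add_pow_char_of_commute _ (Commute.sum_right _ _ _ fun j _ => h i j)

/-! ### Conjugation traces, and the action of a subgroup of order p on abelian subgroups. -/

section Trace

open MonoidAlgebra

variable {F G : Type*} [Field F] [Group G] (A : Subgroup G) [Fintype A]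

/-- The sum of the conjugates of a group element under a finite subgroup, with multiplicity. -/
noncomputable def conjTrace (F : Type*) [Field F] (x : G) : MonoidAlgebra F G :=
  ∑ a : A, of F G (a * x * (a : G)⁻¹)

/-- Write ax = (axa⁻¹)a and absorb a into Â. Products with several factors Â thus become products of
traces, which commute when the conjugates do. -/
lemma hat_mul_of_mul_hat (x : G) : hat F A * of F G x * hat F A = conjTrace A F x * hat F A := by
  nth_rewrite 1 [hat]
  rw [conjTrace, Finset.sum_mul, Finset.sum_mul, Finset.sum_mul]
  refine Finset.sum_congr rfl fun a _ => ?_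
  nth_rewrite 2 [← of_mul_hat a.2]
  rw [← mul_assoc, ← map_mul, ← map_mul, inv_mul_cancel_right]

lemma commute_hat_conjTrace (x : G) : Commute (hat F A) (conjTrace A F x) := by
  refine Commute.sum_left _ _ _ fun b _ => ?_
  rw [Commute, SemiconjBy, conjTrace, Finset.mul_sum, Finset.sum_mul]
  refine Fintype.sum_equiv (Equiv.mulLeft b) _ _ fun a => ?_
  rw [← map_mul, ← map_mul]
  congr 1
  simp [mul_assoc]

lemma conjTrace_mul_conjTrace (x y : G) :
    conjTrace A F x * conjTrace A F y = ∑ a : A, conjTrace A F (x * (a * y * (a : G)⁻¹)) := by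
  simp only [conjTrace]
  rw [Finset.sum_comm, Finset.sum_mul]
  refine Finset.sum_congr rfl fun b _ => ?_
  rw [Finset.mul_sum]
  refine (Fintype.sum_equiv (Equiv.mulLeft b) _ _ fun a => ?_).symm
  rw [← map_mul]
  congr 1
  simp [mul_assoc]

section Abelian

variable {A} {U : Subgroup G} (hU : ∀ x ∈ U, ∀ y ∈ U, x * y = y * x)
  (hAU : ∀ a ∈ A, ∀ u ∈ U, a * u * a⁻¹ ∈ U)

include hU hAU

lemma commute_conjTrace {x y : G} (hx : x ∈ U) (hy : y ∈ U) :
    Commute (conjTrace A F x) (conjTrace A F y) :=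
  Commute.sum_left _ _ _ fun a _ => Commute.sum_right _ _ _ fun b _ => by
    rw [Commute, SemiconjBy, ← map_mul, ← map_mul,
      hU _ (hAU a a.2 x hx) _ (hAU b b.2 y hy)]

lemma conjTrace_pow_char (p : ℕ) [Fact p.Prime] [CharP F p] {x : G} (hx : x ∈ U) :
    conjTrace A F x ^ p = conjTrace A F (x ^ p) := by
  have : CharP (MonoidAlgebra F G) p := charP_of_injective_algebraMap' F p
  rw [conjTrace, sum_pow_char_of_commute p, conjTrace]
  · refine Finset.sum_congr rfl fun a _ => ?_
    rw [← map_pow, conj_pow]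
  · intro a b
    rw [Commute, SemiconjBy, ← map_mul, ← map_mul,
      hU _ (hAU a a.2 x hx) _ (hAU b b.2 x hx)]

end Abelian

end Trace

namespace SymmetricIdentity

open MonoidAlgebra

variable {F G : Type*} [Field F] [Group G] {w : FreeGroup ℕ}
  (H : SymmetricIdentity F (MonoidAlgebra F G) w) {A : Subgroup G} [Fintype A]
  (hA : (Nat.card A : F) = 0)

include H hA

/-- This is c*ac = 0 for c = Â and a = x Â s Â x⁻¹; both square to zero because Â² = 0. -/
lemma hat_mul_symm_mul_hat (x : G) {s : MonoidAlgebra F G} (hs : star s = s) :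
    hat F A * of F G x * hat F A * s * hat F A * of F G x⁻¹ * hat F A = 0 := by
  have h0 : hat F A * hat F A = 0 := by rw [hat_mul_hat, hA, zero_smul]
  have h1 := H.star_mul_mul_eq_zero (a := of F G x * hat F A * s * hat F A * of F G x⁻¹)
    (c := hat F A)
    (by
      have : of F G x⁻¹ * of F G x = 1 := by rw [← map_mul, inv_mul_cancel, map_one]
      calc _ = of F G x * hat F A * s * hat F A * (of F G x⁻¹ * of F G x) * hat F A * s * hat F A *
            of F G x⁻¹ := by simp only [mul_assoc]
        _ = of F G x * hat F A * s * (hat F A * hat F A) * s * hat F A * of F G x⁻¹ := by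
          rw [this]; simp only [mul_assoc, one_mul]
        _ = 0 := by rw [h0]; simp)
    (by simp only [star_mul, star_of, star_hat, hs, inv_inv, mul_assoc])
    (by rw [star_hat, h0])
  rw [star_hat] at h1
  simpa only [mul_assoc] using h1

lemma conjTrace_mul_add {U : Subgroup G} (hU : ∀ x ∈ U, ∀ y ∈ U, x * y = y * x)
    (hAU : ∀ a ∈ A, ∀ u ∈ U, a * u * a⁻¹ ∈ U) {x y : G} (hx : x ∈ U) (hy : y ∈ U) :
    conjTrace A F x * conjTrace A F x⁻¹ * conjTrace A F y * hat F A =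
      - (conjTrace A F x * conjTrace A F x⁻¹ * conjTrace A F y⁻¹ * hat F A) := by
  have key : ∀ {z : G}, z ∈ U →
      hat F A * of F G x * hat F A * of F G z * hat F A * of F G x⁻¹ * hat F A =
      conjTrace A F x * conjTrace A F x⁻¹ * conjTrace A F z * hat F A := by
    intro z hz
    calc _ = hat F A * of F G x * (hat F A * of F G z * hat F A) * of F G x⁻¹ * hat F A := by
          simp only [mul_assoc]
      _ = hat F A * of F G x * conjTrace A F z * (hat F A * of F G x⁻¹ * hat F A) := by
          rw [hat_mul_of_mul_hat]; simp only [mul_assoc]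
      _ = hat F A * of F G x * (conjTrace A F z * conjTrace A F x⁻¹ * hat F A) := by
          rw [hat_mul_of_mul_hat]; simp only [mul_assoc]
      _ = (hat F A * of F G x * hat F A) * (conjTrace A F z * conjTrace A F x⁻¹) := by
          rw [← ((commute_hat_conjTrace A z).mul_right (commute_hat_conjTrace A x⁻¹)).eq]
          simp only [mul_assoc]
      _ = conjTrace A F x * (hat F A * (conjTrace A F z * conjTrace A F x⁻¹)) := by
          rw [hat_mul_of_mul_hat]; simp only [mul_assoc]
      _ = _ := by
          rw [((commute_hat_conjTrace A z).mul_right (commute_hat_conjTrace A x⁻¹)).eq,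
            (commute_conjTrace hU hAU hz (inv_mem hx)).eq]
          simp only [mul_assoc]
  have h := H.hat_mul_symm_mul_hat hA x (s := of F G y + of F G y⁻¹) (by
    rw [star_add, star_of, star_of, inv_inv, add_comm])
  rw [← key hy, ← key (inv_mem hy), eq_neg_iff_add_eq_zero, ← h]
  simp only [mul_add, add_mul]

/-- Let v be the product of the traces of x and x⁻¹, expanded as a sum of traces of elements y =
x(ax⁻¹a⁻¹). Inverting each y changes the sign of v · trace(y) · Â, but only interchanges x and x⁻¹
in the sum. Hence v²Â = −v²Â. -/
lemma conjTrace_sq_mul {U : Subgroup G} (hU : ∀ x ∈ U, ∀ y ∈ U, x * y = y * x)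
    (hAU : ∀ a ∈ A, ∀ u ∈ U, a * u * a⁻¹ ∈ U) {x : G} (hx : x ∈ U) :
    (conjTrace A F x * conjTrace A F x⁻¹) ^ 2 * hat F A = 0 := by
  set v := conjTrace A F x * conjTrace A F x⁻¹ with hv
  have hE : ∀ {y : G}, y ∈ U → v * conjTrace A F y * hat F A =
      -(v * conjTrace A F y⁻¹ * hat F A) := fun hy => H.conjTrace_mul_add hA hU hAU hx hy
  have hC : ∀ {y z : G}, y ∈ U → z ∈ U → Commute (conjTrace A F y) (conjTrace A F z) :=
    fun hy hz => commute_conjTrace hU hAU hy hz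
  have hx' := inv_mem hx
  have h1 : v * (conjTrace A F x * conjTrace A F x⁻¹) * hat F A =
      -(v * (conjTrace A F x⁻¹ * conjTrace A F x) * hat F A) := by
    rw [conjTrace_mul_conjTrace, conjTrace_mul_conjTrace, Finset.mul_sum, Finset.mul_sum,
      Finset.sum_mul, Finset.sum_mul, ← Finset.sum_neg_distrib]
    refine Finset.sum_congr rfl fun a _ => ?_
    rw [hE (mul_mem hx (hAU a a.2 _ hx')), mul_inv_rev, hU _ (inv_mem (hAU a a.2 _ hx')) _ hx']
    congr 5
    group
  rw [(hC hx' hx).eq, ← hv, eq_neg_iff_add_eq_zero, ← two_smul F, smul_eq_zero] at h1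
  rw [pow_two]
  exact h1.resolve_left H.two_ne_zero

/-- Since p ≥ 2, also vᵖÂ = 0, and Frobenius turns vᵖ into the product of the traces of xᵖ and x⁻ᵖ.
That product is supported on U, and U ∩ A = 1, so the factor Â can be dropped. -/
lemma conjTrace_pow_mul_eq_zero (p : ℕ) [Fact p.Prime] [CharP F p] {U : Subgroup G}
    (hU : ∀ x ∈ U, ∀ y ∈ U, x * y = y * x) (hAU : ∀ a ∈ A, ∀ u ∈ U, a * u * a⁻¹ ∈ U)
    (hUA : ∀ u ∈ U, u ∈ A → u = 1) {x : G} (hx : x ∈ U) {d : G} (hd : d ∈ U) :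
    (conjTrace A F (x ^ p) * conjTrace A F (x ^ p)⁻¹).coeff d = 0 := by
  classical
  have h2 := (Fact.out : p.Prime).two_le
  have hC := commute_conjTrace (F := F) hU hAU hx (inv_mem hx)
  have h1 : conjTrace A F (x ^ p) * conjTrace A F (x ^ p)⁻¹ * hat F A = 0 := by
    rw [← inv_pow, ← conjTrace_pow_char hU hAU p hx, ← conjTrace_pow_char hU hAU p (inv_mem hx),
      ← hC.mul_pow, ← Nat.sub_add_cancel h2, pow_add, mul_assoc, H.conjTrace_sq_mul hA hU hAU hx,
      mul_zero]
  have h3 := congrArg (fun y => y.coeff d) h1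
  have hsupp : ∀ u, u ∉ U → (conjTrace A F (x ^ p) * conjTrace A F (x ^ p)⁻¹).coeff u = 0 := by
    intro u hu
    rw [conjTrace, conjTrace, Finset.sum_mul_sum]
    simp only [coeff_sum, Finsupp.finsetSum_apply]
    refine Finset.sum_eq_zero fun a _ => Finset.sum_eq_zero fun b _ => ?_
    rw [← map_mul, of_apply, coeff_single, Finsupp.single_apply, if_neg]
    rintro rfl
    exact hu (mul_mem (hAU a a.2 _ (pow_mem hx p)) (hAU b b.2 _ (inv_mem (pow_mem hx p))))
  rw [hat, Finset.mul_sum] at h3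
  simp only [coeff_sum, Finsupp.finsetSum_apply, coeff_mul_of] at h3
  rw [Finset.sum_eq_single 1] at h3
  · simpa using h3
  · intro a _ ha
    refine hsupp _ fun hm => ha (Subtype.ext (hUA a ?_ a.2))
    have := (U.mul_mem_cancel_left hd).1 hm
    exact inv_mem_iff.1 this
  · simp

omit [Fintype A] hA in
/-- A subgroup of order `p = char F` centralises every abelian subgroup without elements of order
`p` that it normalises. -/
theorem conj_eq_of_card_eq (p : ℕ) [Fact p.Prime] [CharP F p] [Finite A] (hp : Nat.card A = p)
    {U : Subgroup G} (hU : ∀ x ∈ U, ∀ y ∈ U, x * y = y * x)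
    (hAU : ∀ a ∈ A, ∀ u ∈ U, a * u * a⁻¹ ∈ U) (hUp : ∀ u ∈ U, u ^ p = 1 → u = 1) {a x : G}
    (ha : a ∈ A) (hx : x ∈ U) : a * x * a⁻¹ = x := by
  classical
  have := Fintype.ofFinite A
  have hA : (Nat.card A : F) = 0 := by rw [hp, CharP.cast_eq_zero]
  have hUA : ∀ u ∈ U, u ∈ A → u = 1 := fun u hu hu' => hUp u hu (by
    rw [← hp]; exact orderOf_dvd_iff_pow_eq_one.1 (A.orderOf_dvd_natCard hu'))
  set X := x ^ p with hX
  have hXU : X ∈ U := pow_mem hx p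
  -- The p-th power of axa⁻¹x⁻¹ is aXa⁻¹X⁻¹, and U has no elements of order p.
  suffices hfix : a * X * a⁻¹ = X by
    have h1 : (a * x * a⁻¹ * x⁻¹) ^ p = 1 := by
      have hc : Commute (a * x * a⁻¹) x⁻¹ := hU _ (hAU a ha x hx) _ (inv_mem hx)
      rw [hc.mul_pow, conj_pow, ← hX, hfix, inv_pow, mul_inv_cancel]
    exact mul_inv_eq_one.1 (hUp _ (mul_mem (hAU a ha x hx) (inv_mem hx)) h1)
  by_contra hne
  set d := a * X * a⁻¹ * X⁻¹ with hd
  have hdU : d ∈ U := mul_mem (hAU a ha X hXU) (inv_mem hXU)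
  have hinj : ∀ b c : A, (b : G) * X * (b : G)⁻¹ = c * X * (c : G)⁻¹ → b = c := by
    intro b c hbc
    let S : Subgroup A := (Subgroup.centralizer {X}).subgroupOf A
    have hS : S = ⊥ := by
      have hprime : (Nat.card A).Prime := by rw [hp]; exact Fact.out
      have := Fact.mk hprime
      refine (S.eq_bot_or_eq_top_of_prime_card).resolve_right fun h => hne ?_
      have : (⟨a, ha⟩ : A) ∈ S := h ▸ Subgroup.mem_top _
      rw [Subgroup.mem_subgroupOf, Subgroup.mem_centralizer_singleton_iff] at this
      rw [this, mul_inv_cancel_right]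
    have : c⁻¹ * b ∈ S := by
      rw [Subgroup.mem_subgroupOf, Subgroup.mem_centralizer_singleton_iff]
      push_cast
      calc (c : G)⁻¹ * b * X = (c : G)⁻¹ * (b * X * (b : G)⁻¹) * b := by group
        _ = X * ((c : G)⁻¹ * b) := by rw [hbc]; group
    rw [hS, Subgroup.mem_bot, inv_mul_eq_one] at this
    exact this.symm
  -- |S| is, modulo p, the vanishing coefficient at d of the trace product. S contains (a, 1), so it
  -- has at least p elements. Its second coordinate is injective, hence takes every value in A:
  -- multiplication by d permutes the conjugates of X, so dᵖ = 1.
  let S : Finset (A × A) := Finset.univ.filter fun q =>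
    (q.1 : G) * X * (q.1 : G)⁻¹ * (q.2 * X * (q.2 : G)⁻¹)⁻¹ = d
  have hS0 : (S.card : F) = 0 := by
    rw [← H.conjTrace_pow_mul_eq_zero hA p hU hAU hUA hx hdU, conjTrace, conjTrace,
      Finset.sum_mul_sum, ← Finset.sum_product']
    simp only [coeff_sum, Finsupp.finsetSum_apply]
    rw [Finset.card_filter, Nat.cast_sum]
    refine Finset.sum_congr rfl fun q _ => ?_
    rw [← map_mul, of_apply, coeff_single, Finsupp.single_apply, ← hX]
    simp [mul_assoc]
  have hdvd : p ∣ S.card := (CharP.cast_eq_zero_iff F p _).1 hS0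
  have hmem : ((⟨a, ha⟩, 1) : A × A) ∈ S := by
    simp [S, hd, mul_assoc]
  have hle : p ≤ S.card := Nat.le_of_dvd (Finset.card_pos.2 ⟨_, hmem⟩) hdvd
  have hSinj : Set.InjOn Prod.snd (S : Set (A × A)) := by
    rintro ⟨b, c⟩ hb ⟨b', c'⟩ hb' h
    have h1 := (Finset.mem_filter.1 hb).2
    have h2 := (Finset.mem_filter.1 hb').2
    obtain rfl : c = c' := h
    have h3 : b = b' := hinj _ _ (mul_right_cancel (h1.trans h2.symm))
    rw [h3]
  have himg : S.image Prod.snd = Finset.univ := by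
    refine Finset.eq_univ_of_card _ (le_antisymm (Finset.card_le_univ _) ?_)
    rw [Finset.card_image_of_injOn hSinj, ← Nat.card_eq_fintype_card, hp]
    exact hle
  let _ : CommGroup U := { (inferInstance : Group U) with
    mul_comm := fun y z => Subtype.ext (hU y y.2 z z.2) }
  have hdp : (⟨d, hdU⟩ : U) ^ Fintype.card A = 1 := by
    refine pow_card_eq_one_of_injective
      (f := fun b : A => (⟨b * X * (b : G)⁻¹, hAU b b.2 X hXU⟩ : U)) ?_ ?_
    · exact fun b c h => hinj b c (congrArg Subtype.val h)
    · intro c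
      have hc : c ∈ S.image Prod.snd := himg ▸ Finset.mem_univ c
      obtain ⟨⟨b, c'⟩, hb, rfl⟩ := Finset.mem_image.1 hc
      refine ⟨b, Subtype.ext ?_⟩
      have h1 := (Finset.mem_filter.1 hb).2
      exact mul_inv_eq_iff_eq_mul.1 h1
  have hd1 : d = 1 := hUp d hdU (by
    rw [← hp, Nat.card_eq_fintype_card]; exact congrArg Subtype.val hdp)
  exact hne (mul_inv_eq_one.1 hd1)

end SymmetricIdentity

/-! ### Absence of elements of order p. -/

namespace SymmetricIdentity

open MonoidAlgebra

variable {F G : Type*} [Field F] [Group G] {w : FreeGroup ℕ}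
  (H : SymmetricIdentity F (MonoidAlgebra F G) w) (p : ℕ) [Fact p.Prime] [CharP F p]

include H

lemma eq_one_of_mem_fcCenter {u : G} (hu : u ∈ fcCenter G) (h : u ^ p = 1) : u = 1 := by
  by_contra hne
  have ho : orderOf u = p := orderOf_eq_prime h hne
  refine H.isOfFinOrder_natCast_orderOf_ne_zero hu
    (isOfFinOrder_iff_pow_eq_one.2 ⟨p, (Fact.out : p.Prime).pos, h⟩) ?_
  rw [ho, CharP.cast_eq_zero]

/-- Some power yᴺ commutes with all ⟨g⟩-conjugates of y, so its conjugates generate an abelian group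
without elements of order p, which g centralises. Then τ = y⁻¹(gyg⁻¹) has finite order prime to p
and ⟨τ⟩ is normal, so g centralises τ as well. Thus gᵖyg⁻ᵖ = yτᵖ, which gives τᵖ = 1 and τ = 1. -/
lemma fcCenter_le_centralizer {g : G} (hg : orderOf g = p) :
    fcCenter G ≤ Subgroup.centralizer {g} := by
  classical
  have hp := (Fact.out : p.Prime)
  intro y hy
  have hA : Nat.card (Subgroup.zpowers g) = p := by rw [Nat.card_zpowers, hg]
  have hfin : Finite (Subgroup.zpowers g) := Nat.finite_of_card_ne_zero (hA ▸ hp.ne_zero)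
  have := Fintype.ofFinite (Subgroup.zpowers g)
  have hΔ : (fcCenter G).Normal := inferInstance
  have hex : ∀ a : Subgroup.zpowers g, ∃ n, 0 < n ∧
      y ^ n ∈ Subgroup.centralizer {(a : G) * y * (a : G)⁻¹} := fun a =>
    pow_mem_centralizer (hΔ.conj_mem y hy a) y
  choose n hn hc using hex
  set N := ∏ a, n a with hN
  have hN0 : 0 < N := Finset.prod_pos fun a _ => hn a
  have hcomm : ∀ a : Subgroup.zpowers g, Commute (y ^ N) ((a : G) * y * (a : G)⁻¹) := by
    intro a
    obtain ⟨k, hk⟩ : n a ∣ N := Finset.dvd_prod_of_mem n (Finset.mem_univ a)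
    rw [hk, pow_mul]
    exact Commute.pow_left (Subgroup.mem_centralizer_singleton_iff.1 (hc a)) k
  let S : Set G := Set.range fun a : Subgroup.zpowers g => (a : G) * y ^ N * (a : G)⁻¹
  have hS : ∀ s ∈ S, ∀ t ∈ S, s * t = t * s := by
    rintro _ ⟨a, rfl⟩ _ ⟨b, rfl⟩
    have h1 := ((hcomm (a⁻¹ * b)).pow_right N).eq
    rw [conj_pow] at h1
    push_cast at h1
    calc (a : G) * y ^ N * (a : G)⁻¹ * (b * y ^ N * (b : G)⁻¹)
        = a * (y ^ N * ((a : G)⁻¹ * b * y ^ N * ((a : G)⁻¹ * b)⁻¹)) * (a : G)⁻¹ := by group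
      _ = _ := by rw [h1]; group
  set U := Subgroup.closure S
  have hUcomm : ∀ x ∈ U, ∀ z ∈ U, x * z = z * x := by
    intro x hx z hz
    have := Subgroup.isMulCommutative_closure hS
    exact setLike_mul_comm hx hz
  have hAU : ∀ a ∈ Subgroup.zpowers g, ∀ u ∈ U, a * u * a⁻¹ ∈ U := by
    intro a ha u hu
    have h1 : U ≤ U.comap (MulAut.conj a).toMonoidHom := by
      rw [Subgroup.closure_le]
      rintro _ ⟨b, rfl⟩
      refine Subgroup.subset_closure ⟨⟨a, ha⟩ * b, ?_⟩
      simp [mul_assoc]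
    exact h1 hu
  have hUΔ : U ≤ fcCenter G := by
    rw [Subgroup.closure_le]
    rintro _ ⟨b, rfl⟩
    exact hΔ.conj_mem _ (pow_mem hy N) b
  have hgm := Subgroup.mem_zpowers g
  have h1 : g * y ^ N * g⁻¹ = y ^ N :=
    H.conj_eq_of_card_eq p hA hUcomm hAU (fun u hu => H.eq_one_of_mem_fcCenter p (hUΔ hu)) hgm
      (Subgroup.subset_closure ⟨1, by simp⟩)
  set τ := y⁻¹ * (g * y * g⁻¹) with hτ
  have hτΔ : τ ∈ fcCenter G := mul_mem (inv_mem hy) (hΔ.conj_mem y hy g)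
  have hτo : IsOfFinOrder τ := isOfFinOrder_inv_mul hy (hΔ.conj_mem y hy g) hN0 (by
    rw [conj_pow, h1])
  have hτp := H.isOfFinOrder_natCast_orderOf_ne_zero hτΔ hτo
  have : Finite (Subgroup.zpowers τ) := finite_zpowers.2 hτo
  have := Fintype.ofFinite (Subgroup.zpowers τ)
  have hτn := H.normal_of_card_ne_zero (Subgroup.zpowers τ) (by rwa [Nat.card_zpowers])
  have hτg : g * τ * g⁻¹ = τ := by
    refine H.conj_eq_of_card_eq p hA (U := Subgroup.zpowers τ) ?_
      (fun a _ u hu => hτn.conj_mem u hu a)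
      (fun u hu => H.eq_one_of_mem_fcCenter p ((Subgroup.zpowers_le.2 hτΔ) hu)) hgm
      (Subgroup.mem_zpowers τ)
    rintro _ ⟨i, rfl⟩ _ ⟨j, rfl⟩
    exact ((Commute.refl τ).zpow_zpow i j).eq
  have hgτ : Commute g τ := mul_inv_eq_iff_eq_mul.1 hτg
  have hconj : ∀ i : ℕ, g ^ i * y * (g ^ i)⁻¹ = y * τ ^ i := by
    intro i
    induction i with
    | zero => simp
    | succ i ih =>
      have h2 : g * y * g⁻¹ = y * τ := by rw [hτ]; group
      calc g ^ (i + 1) * y * (g ^ (i + 1))⁻¹ = g * (g ^ i * y * (g ^ i)⁻¹) * g⁻¹ := by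
            rw [pow_succ']; group
        _ = (g * y * g⁻¹) * (g * τ ^ i * g⁻¹) := by rw [ih]; group
        _ = y * τ ^ (i + 1) := by
          rw [h2, (hgτ.pow_right i).eq, mul_inv_cancel_right, pow_succ', mul_assoc]
  have hτ1 : τ = 1 := by
    refine H.eq_one_of_mem_fcCenter p hτΔ ?_
    have h2 := hconj p
    rw [← hg, pow_orderOf_eq_one] at h2
    rw [← hg]
    simpa using h2.symm
  rw [Subgroup.mem_centralizer_singleton_iff]
  have h2 := hconj 1
  rw [hτ1, pow_one, one_pow, mul_one] at h2
  exact (mul_inv_eq_iff_eq_mul.1 h2).symm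

end SymmetricIdentity

/-- Generic elements for a finite family which is separated modulo an FC-centre of infinite
index. -/
lemma exists_generic {G I : Type*} [Group G] [Finite I] (k : I → G) (o : I)
    (hk : ∀ i j, (k i)⁻¹ * k j ∈ fcCenter G → i = j) (hΔ : ¬ (fcCenter G).FiniteIndex) :
    ∃ r t : G, (∀ a b c, k a * r * (k b)⁻¹ * t * (k c)⁻¹ = k o * r * (k o)⁻¹ * t * (k o)⁻¹ →
      a = o ∧ b = o ∧ c = o) ∧
      ∀ a b c, k a * t⁻¹ * k b * r * (k c)⁻¹ ≠ k o * r * (k o)⁻¹ * t * (k o)⁻¹ := by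
  classical
  have := Fintype.ofFinite I
  have hΔn : (fcCenter G).Normal := inferInstance
  -- The first family settles b once a = o is known. The cosets to be avoided keep k(o)⁻¹ k(a) t⁻¹
  -- k(b) out of the FC-centre, as needed when r is chosen.
  obtain ⟨t, ht1, ht2⟩ := exists_conj_ne
    ((Finset.univ.filter fun q : I × I => q.1 ≠ o).image
      fun q => (k q.1 * (k o)⁻¹, (k q.2)⁻¹ * k o)) (by
      intro q hq
      obtain ⟨⟨b, c⟩, hb, rfl⟩ := Finset.mem_image.1 hq
      intro h
      refine (Finset.mem_filter.1 hb).2 (hk o b ?_).symm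
      have := hΔn.conj_mem _ h (k o)⁻¹
      simpa [mul_assoc] using this)
    (Finset.univ.image fun q : I × I => k q.2 * (k o)⁻¹ * k q.1) (fun _ => hΔ)
  have ht2' : ∀ a b, (k o)⁻¹ * k a * t⁻¹ * k b ∉ fcCenter G := by
    intro a b h
    refine ht2 (k b * (k o)⁻¹ * k a) (Finset.mem_image.2 ⟨(a, b), Finset.mem_univ _, rfl⟩) ?_
    have := inv_mem (hΔn.conj_mem _ h ((k b * (k o)⁻¹ * k a)⁻¹ * t * (k a)⁻¹ * k o))
    convert this using 1
    group
  obtain ⟨r, hr, -⟩ := exists_conj_ne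
    (((Finset.univ.filter fun q : I × I × I => q.1 ≠ o).image fun q =>
        ((k o)⁻¹ * k q.1, (k o)⁻¹ * t * (k o)⁻¹ * k q.2.2 * t⁻¹ * k q.2.1)) ∪
      (Finset.univ.image fun q : I × I × I =>
        ((k o)⁻¹ * k q.1 * t⁻¹ * k q.2.1, (k o)⁻¹ * t * (k o)⁻¹ * k q.2.2))) (by
      intro q hq
      rcases Finset.mem_union.1 hq with hq | hq
      · obtain ⟨⟨a, b, c⟩, ha, rfl⟩ := Finset.mem_image.1 hq
        exact fun h => (Finset.mem_filter.1 ha).2 (hk o a h).symm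
      · obtain ⟨⟨a, b, c⟩, ha, rfl⟩ := Finset.mem_image.1 hq
        exact ht2' a b) ∅ (fun h => absurd h Finset.not_nonempty_empty)
  refine ⟨r, t, fun a b c h => ?_, fun a b c h => ?_⟩
  · have ha : a = o := by
      by_contra hne
      refine hr _ (Finset.mem_union_left _ (Finset.mem_image.2 ⟨(a, b, c),
        Finset.mem_filter.2 ⟨Finset.mem_univ _, hne⟩, rfl⟩)) ?_
      calc r⁻¹ * ((k o)⁻¹ * k a) * r
          = r⁻¹ * (k o)⁻¹ * (k a * r * (k b)⁻¹ * t * (k c)⁻¹) * k c * t⁻¹ * k b := by group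
        _ = _ := by rw [h]; group
    subst ha
    have hb : b = a := by
      by_contra hne
      refine ht1 _ (Finset.mem_image.2 ⟨(b, c),
        Finset.mem_filter.2 ⟨Finset.mem_univ _, hne⟩, rfl⟩) ?_
      calc t⁻¹ * (k b * (k a)⁻¹) * t = t⁻¹ * k b * r⁻¹ * (k a)⁻¹ *
            (k a * r * (k a)⁻¹ * t * (k a)⁻¹) * k a := by group
        _ = _ := by rw [← h]; group
    subst hb
    refine ⟨rfl, rfl, (hk _ _ ?_).symm⟩
    have := mul_left_cancel h
    rw [inv_inj] at this
    rw [this, inv_mul_cancel]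
    exact one_mem _
  · refine hr _ (Finset.mem_union_right _ (Finset.mem_image.2 ⟨(a, b, c),
      Finset.mem_univ _, rfl⟩)) ?_
    calc r⁻¹ * ((k o)⁻¹ * k a * t⁻¹ * k b) * r
        = r⁻¹ * (k o)⁻¹ * (k a * t⁻¹ * k b * r * (k c)⁻¹) * k c := by group
      _ = _ := by rw [h]; group

/-- The hypothesis says D r D* = −D r* D*; use it once for r D* t and once for r. -/
lemma mul_mul_star_mul_mul_star {R : Type*} [Ring R] [StarRing R] {D : R}
    (hD : ∀ s, star s = s → D * s * star D = 0) (r t : R) :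
    D * r * star D * t * star D = D * star t * D * r * star D := by
  have h : ∀ r, D * r * star D = -(D * star r * star D) := fun r => by
    rw [eq_neg_iff_add_eq_zero, ← add_mul, ← mul_add]
    exact hD _ (by rw [star_add, star_star, add_comm])
  calc D * r * star D * t * star D = D * (r * star D * t) * star D := by simp only [mul_assoc]
    _ = -(D * star t * (D * star r * star D)) := by
      rw [h]; simp only [star_mul, star_star, mul_assoc]
    _ = _ := by rw [← neg_neg (D * star r * star D), ← h]; simp only [mul_neg, neg_neg, mul_assoc]

namespace SymmetricIdentity

open MonoidAlgebra

variable {F G : Type*} [Field F] [Group G] {w : FreeGroup ℕ}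
  (H : SymmetricIdentity F (MonoidAlgebra F G) w) (p : ℕ) [Fact p.Prime] [CharP F p]

include H

/-- For A = ⟨g⟩ and D = Â x Â one has D r D* t D* = D t* D r D*. If the p² group elements in D are
distinct modulo the FC-centre, suitable r and t make one group element occur exactly once on the
left and never on the right. -/
theorem orderOf_ne (g : G) : orderOf g ≠ p := by
  classical
  intro hg
  have hp := (Fact.out : p.Prime)
  set A := Subgroup.zpowers g with hAdef
  have hA : Nat.card A = p := by rw [Nat.card_zpowers, hg]
  have hA0 : (Nat.card A : F) = 0 := by rw [hA, CharP.cast_eq_zero]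
  have hprime := Fact.mk (hA ▸ hp)
  have hfin : Finite A := Nat.finite_of_card_ne_zero (hA ▸ hp.ne_zero)
  have := Fintype.ofFinite A
  have hΔn : (fcCenter G).Normal := inferInstance
  have hΔg := H.fcCenter_le_centralizer p hg
  have hg1 : g ≠ 1 := fun h => hp.ne_one (by rw [← hg, h, orderOf_one])
  have hAp : ∀ a ∈ A, a ^ p = 1 := fun a ha => by
    rw [← hA]; exact orderOf_dvd_iff_pow_eq_one.1 (A.orderOf_dvd_natCard ha)
  have hΔ : ¬ (fcCenter G).FiniteIndex := fun h => hg1 <| by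
    have hgΔ : g ∈ fcCenter G := Subgroup.finiteIndex_of_le hΔg
    exact H.eq_one_of_mem_fcCenter p hgΔ (hAp g (Subgroup.mem_zpowers g))
  -- Otherwise every conjugate of g is aδ with a ∈ A and δ in the FC-centre, commuting with a. Then
  -- δᵖ = 1, so δ = 1, and A would be normal of order p.
  obtain ⟨x, hx⟩ : ∃ x : G, x⁻¹ * g * x ∉ A ⊔ fcCenter G := by
    by_contra! hcon
    have hAn : A.Normal := by
      have h1 : ∀ x : G, x⁻¹ * g * x ∈ A := by
        intro x
        obtain ⟨a, ha, δ, hδ, h⟩ := Subgroup.mem_sup_of_normal_right.1 (hcon x)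
        have hc : Commute a δ := by
          obtain ⟨i, rfl⟩ := ha
          have : Commute δ g := Subgroup.mem_centralizer_singleton_iff.1 (hΔg hδ)
          exact (this.zpow_right i).symm
        have h2 : (x⁻¹ * g * x) ^ p = 1 := by
          have := conj_pow (a := x⁻¹) (b := g) (i := p)
          rw [inv_inv] at this
          rw [this, hAp g (Subgroup.mem_zpowers g)]; simp
        rw [← h, hc.mul_pow, hAp a ha, one_mul] at h2
        rw [← h, H.eq_one_of_mem_fcCenter p hδ h2, mul_one]
        exact ha
      refine ⟨fun a ha y => ?_⟩
      obtain ⟨i, rfl⟩ := ha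
      change y * g ^ i * y⁻¹ ∈ A
      rw [← conj_zpow]
      refine zpow_mem ?_ i
      simpa using h1 y⁻¹
    exact H.card_ne_zero_of_normal A hA0
  have hx' : ∀ a : A, x⁻¹ * a * x ∈ A ⊔ fcCenter G → a = 1 := by
    intro a ha
    by_contra hne
    have htop := zpowers_eq_top_of_prime_card rfl hne
    have : (⟨g, Subgroup.mem_zpowers g⟩ : A) ∈ Subgroup.zpowers a := htop ▸ Subgroup.mem_top _
    obtain ⟨i, hi⟩ := this
    have hi' : (a : G) ^ i = g := congrArg Subtype.val hi
    refine hx ?_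
    have h1 := zpow_mem ha i
    have h2 := conj_zpow (a := x⁻¹) (b := (a : G)) (i := i)
    rw [inv_inv] at h2
    rwa [h2, hi'] at h1
  let k : A × A → G := fun q => q.1 * x * q.2
  have hk : ∀ i j, (k i)⁻¹ * k j ∈ fcCenter G → i = j := by
    rintro ⟨a, b⟩ ⟨c, d⟩ h
    have h1 : a⁻¹ * c = 1 := by
      refine hx' _ ?_
      have h2 : x⁻¹ * (a⁻¹ * c : A) * x = b * ((k (a, b))⁻¹ * k (c, d)) * (d : G)⁻¹ := by
        simp only [k]; push_cast; group
      rw [h2]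
      exact mul_mem (mul_mem (Subgroup.mem_sup_left b.2) (Subgroup.mem_sup_right h))
        (Subgroup.mem_sup_left (inv_mem d.2))
    obtain rfl := inv_mul_eq_one.1 h1
    have h3 : (b⁻¹ * d : A) = (1 : A) := by
      refine Subtype.ext (H.eq_one_of_mem_fcCenter p ?_ (hAp _ (b⁻¹ * d).2))
      convert h using 1
      simp only [k]; push_cast; group
    rw [inv_mul_eq_one.1 h3]
  obtain ⟨r, t, h1, h2⟩ := exists_generic k (1, 1) hk hΔ
  set D := hat F A * of F G x * hat F A with hDdef
  have hDsum : D = ∑ q, of F G (k q) := by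
    rw [hDdef, hat, Finset.sum_mul, Finset.sum_mul_sum, Fintype.sum_prod_type]
    simp only [k, map_mul]
  have hDstar : star D = ∑ q, of F G (k q)⁻¹ := by
    rw [hDsum, star_sum]
    simp only [star_of]
  have hD0 : ∀ s, star s = s → D * s * star D = 0 := by
    intro s hs
    have h3 := H.hat_mul_symm_mul_hat hA0 x hs
    rw [hDdef, star_mul, star_mul, star_hat, star_of, ← h3]
    simp only [mul_assoc]
  have key := congrArg (fun y => y.coeff (k (1, 1) * r * (k (1, 1))⁻¹ * t * (k (1, 1))⁻¹))
    (mul_mul_star_mul_mul_star hD0 (of F G r) (of F G t))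
  rw [hDstar, hDsum, star_of] at key
  simp only [Finset.sum_mul, Finset.mul_sum, coeff_sum, Finsupp.finsetSum_apply, of_apply,
    single_mul_single, mul_one, coeff_single, Finsupp.single_apply, h2, if_false,
    Finset.sum_const_zero] at key
  rw [Finset.sum_eq_single (1, 1), Finset.sum_eq_single (1, 1), Finset.sum_eq_single (1, 1),
    if_pos rfl] at key
  · exact one_ne_zero key
  · exact fun a _ ha => if_neg fun h => ha (h1 _ _ _ h).1
  · simp
  · exact fun b _ hb => Finset.sum_eq_zero fun a _ => if_neg fun h => hb (h1 _ _ _ h).2.1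
  · simp
  · exact fun c _ hc => Finset.sum_eq_zero fun b _ => Finset.sum_eq_zero fun a _ =>
      if_neg fun h => hc (h1 _ _ _ h).2.2
  · simp

end SymmetricIdentity

/-! ### Subgroup algebras. -/

section SubgroupAlgebra

open MonoidAlgebra

variable {F G : Type*} [Field F] [Group G] {T : Subgroup G}

lemma of_mem_subgroupAlgebra {g : G} (hg : g ∈ T) : of F G g ∈ subgroupAlgebra F T :=
  ⟨of F T ⟨g, hg⟩, by simp⟩

lemma subgroupAlgebra_induction
    {P : (x : MonoidAlgebra F G) → x ∈ subgroupAlgebra F T → Prop}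
    (zero : P 0 (zero_mem _)) (of_mem : ∀ g (hg : g ∈ T), P (of F G g) (of_mem_subgroupAlgebra hg))
    (add : ∀ x y hx hy, P x hx → P y hy → P (x + y) (add_mem hx hy))
    (smul : ∀ (c : F) x hx, P x hx → P (c • x) (Subalgebra.smul_mem _ hx c))
    {x : MonoidAlgebra F G} (hx : x ∈ subgroupAlgebra F T) : P x hx := by
  obtain ⟨y, rfl⟩ := hx
  induction y using induction_of with
  | _zero => simpa using zero
  | of_mem g => simpa using of_mem g g.2
  | add x y hx hy =>
    have := add _ _ _ _ hx hy
    simpa only [map_add] using this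
  | smul c x hx =>
    have := smul c _ _ hx
    have h : c • (mapDomainAlgHom F F T.subtype) x = (mapDomainAlgHom F F T.subtype) (c • x) :=
      (map_smul _ c x).symm
    simp only [AlgHom.toRingHom_eq_coe, RingHom.coe_coe, h] at this
    exact this

lemma coeff_eq_zero_of_mem_subgroupAlgebra {x : MonoidAlgebra F G}
    (hx : x ∈ subgroupAlgebra F T) {g : G} (hg : g ∉ T) : x.coeff g = 0 := by
  classical
  induction hx using subgroupAlgebra_induction with
  | zero => simp
  | of_mem h hh =>
    rw [of_apply, coeff_single, Finsupp.single_apply, if_neg]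
    rintro rfl
    exact hg hh
  | add x y _ _ hx hy => rw [coeff_add, Finsupp.add_apply, hx, hy, add_zero]
  | smul c x _ hx => rw [coeff_smul_apply, hx, smul_zero]

lemma star_mem_subgroupAlgebra {x : MonoidAlgebra F G} (hx : x ∈ subgroupAlgebra F T) :
    star x ∈ subgroupAlgebra F T := by
  induction hx using subgroupAlgebra_induction with
  | zero => rw [star_zero]; exact zero_mem _
  | of_mem g hg => rw [star_of]; exact of_mem_subgroupAlgebra (inv_mem hg)
  | add x y _ _ hx hy => rw [star_add]; exact add_mem hx hy
  | smul c x _ hx => rw [star_smul_monoidAlgebra]; exact Subalgebra.smul_mem _ hx c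

lemma conj_mem_subgroupAlgebra [hT : T.Normal] {x : MonoidAlgebra F G}
    (hx : x ∈ subgroupAlgebra F T) (g : G) :
    of F G g * x * of F G g⁻¹ ∈ subgroupAlgebra F T := by
  induction hx using subgroupAlgebra_induction with
  | zero => rw [mul_zero, zero_mul]; exact zero_mem _
  | of_mem h hh =>
    rw [← map_mul, ← map_mul]; exact of_mem_subgroupAlgebra (hT.conj_mem h hh g)
  | add x y _ _ hx hy => rw [mul_add, add_mul]; exact add_mem hx hy
  | smul c x _ hx => rw [mul_smul_comm, smul_mul_assoc]; exact Subalgebra.smul_mem _ hx c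

lemma commute_of_mem_subgroupAlgebra (hT : ∀ x ∈ T, ∀ y ∈ T, x * y = y * x)
    {x y : MonoidAlgebra F G} (hx : x ∈ subgroupAlgebra F T) (hy : y ∈ subgroupAlgebra F T) :
    Commute x y := by
  induction hx using subgroupAlgebra_induction with
  | zero => exact Commute.zero_left y
  | of_mem g hg =>
    induction hy using subgroupAlgebra_induction with
    | zero => exact Commute.zero_right _
    | of_mem h hh => rw [Commute, SemiconjBy, ← map_mul, hT g hg h hh, map_mul]
    | add x y _ _ hx hy => exact hx.add_right hy
    | smul c x _ hx => exact hx.smul_right c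
  | add x y _ _ hx hy => exact hx.add_left hy
  | smul c x _ hx => exact hx.smul_left c

end SubgroupAlgebra

/-! ### The torsion subgroup, and idempotents when it is abelian. -/

namespace SymmetricIdentity

open MonoidAlgebra

variable {F G : Type*} [Field F] [Group G] {w : FreeGroup ℕ}
  (H : SymmetricIdentity F (MonoidAlgebra F G) w) (p : ℕ) [hp : Fact p.Prime] [hF : CharP F p]

include H hp hF

lemma eq_one_of_pow_char {g : G} (h : g ^ p = 1) : g = 1 := by
  by_contra hne
  exact H.orderOf_ne p g (orderOf_eq_prime h hne)

lemma zpowers_normal {g : G} (hg : IsOfFinOrder g) : (Subgroup.zpowers g).Normal := by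
  have : Finite (Subgroup.zpowers g) := finite_zpowers.2 hg
  have := Fintype.ofFinite (Subgroup.zpowers g)
  refine H.normal_of_card_ne_zero _ ?_
  rw [Nat.card_zpowers]
  intro h
  obtain ⟨k, hk⟩ := (CharP.cast_eq_zero_iff F p _).1 h
  have hk0 : k ≠ 0 := by
    rintro rfl
    exact hg.orderOf_pos.ne' hk
  refine H.orderOf_ne p (g ^ k) ?_
  rw [orderOf_pow_of_dvd hk0 ⟨p, by rw [hk, mul_comm]⟩, hk,
    Nat.mul_div_cancel _ (Nat.pos_of_ne_zero hk0)]

lemma isOfFinOrder_mul {a b : G} (ha : IsOfFinOrder a) (hb : IsOfFinOrder b) :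
    IsOfFinOrder (a * b) := by
  have hn := H.zpowers_normal p ha
  have h1 : (a * b) ^ orderOf b ∈ Subgroup.zpowers a := by
    rw [← QuotientGroup.eq_one_iff, QuotientGroup.mk_pow, QuotientGroup.mk_mul,
      (QuotientGroup.eq_one_iff a).2 (Subgroup.mem_zpowers a), one_mul, ← QuotientGroup.mk_pow,
      pow_orderOf_eq_one, QuotientGroup.mk_one]
  have h2 : IsOfFinOrder ((a * b) ^ orderOf b) := by
    obtain ⟨i, hi⟩ := h1
    rw [← hi]
    exact ha.zpow
  exact h2.of_pow hb.orderOf_pos.ne'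

/-- The elements of finite order form a subgroup. -/
lemma exists_torsion : ∃ T : Subgroup G, ∀ g, g ∈ T ↔ IsOfFinOrder g :=
  ⟨{ carrier := {g | IsOfFinOrder g}
     mul_mem' := fun ha hb => H.isOfFinOrder_mul p ha hb
     one_mem' := IsOfFinOrder.one
     inv_mem' := fun ha => IsOfFinOrder.inv ha }, fun _ => Iff.rfl⟩

omit H hp hF in
lemma normal_of_mem_iff_isOfFinOrder {T : Subgroup G} (h : ∀ g, g ∈ T ↔ IsOfFinOrder g) :
    T.Normal :=
  ⟨fun a ha g => by
    have := (MulAut.conj g).toMonoidHom.isOfFinOrder ((h a).1 ha)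
    rw [h]
    simpa using this⟩

section Abelian

variable {T : Subgroup G} (hmem : ∀ g, g ∈ T ↔ IsOfFinOrder g)
  (hT : ∀ x ∈ T, ∀ y ∈ T, x * y = y * x)

omit hp hF
include hmem hT

/-- For symmetric s, c*ac = 0 with a = e s e* and c = e* reads e s e* = 0. Take s = y + y⁻¹ with y ∉
T: the two summands live on the cosets yT and y⁻¹T, which are disjoint because y² ∉ T, so each
vanishes. -/
lemma mul_mul_star_eq_zero {e : MonoidAlgebra F G} (he : e ∈ subgroupAlgebra F T)
    (hi : IsIdempotentElem e) (hs : e * star e = 0) (r : MonoidAlgebra F G) :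
    e * r * star e = 0 := by
  have hTn := normal_of_mem_iff_isOfFinOrder hmem
  have he' := star_mem_subgroupAlgebra he
  have hc : Commute e (star e) := commute_of_mem_subgroupAlgebra hT he he'
  have hsymm : ∀ s, star s = s → e * s * star e = 0 := by
    intro s hs'
    have h1 := H.star_mul_mul_eq_zero (a := e * s * star e) (c := star e)
      (by
        calc e * s * star e * (e * s * star e) = e * s * (star e * e) * s * star e := by
              simp only [mul_assoc]
          _ = 0 := by rw [← hc.eq, hs]; simp)
      (by simp only [star_mul, star_star, hs', mul_assoc]) (by rw [star_star, hs])
    rw [star_star] at h1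
    have hi' : star e * star e = star e := by rw [← star_mul, hi.eq]
    calc e * s * star e = e * e * s * (star e * star e) := by rw [hi', hi.eq]
      _ = 0 := by rw [← h1]; simp only [mul_assoc]
  induction r using induction_of with
  | _zero => simp
  | of_mem y =>
    by_cases hy : y ∈ T
    · rw [(commute_of_mem_subgroupAlgebra hT he (of_mem_subgroupAlgebra hy)).eq, mul_assoc, hs,
        mul_zero]
    · have hsupp : ∀ (y g : G), (e * of F G y * star e).coeff g ≠ 0 → y⁻¹ * g ∈ T := by
        intro y g hg
        by_contra hn
        refine hg ?_
        have h1 : of F G y⁻¹ * (e * of F G y * star e) ∈ subgroupAlgebra F T := by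
          have h2 := conj_mem_subgroupAlgebra he y⁻¹
          rw [inv_inv] at h2
          have h3 := mul_mem h2 he'
          convert h3 using 1
          simp only [mul_assoc]
        have h4 := coeff_eq_zero_of_mem_subgroupAlgebra h1 hn
        rwa [coeff_of_mul, inv_inv, mul_inv_cancel_left] at h4
      have h0 := hsymm (of F G y + of F G y⁻¹) (by
        rw [star_add, star_of, star_of, inv_inv, add_comm])
      rw [mul_add, add_mul] at h0
      ext g
      by_contra hg
      rw [coeff_zero, Finsupp.zero_apply] at hg
      have h1 := hsupp y g hg
      have h2 := hsupp y⁻¹ g (by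
        intro h
        have h3 := congrArg (fun x => x.coeff g) h0
        simp only [coeff_add, Finsupp.add_apply, h, add_zero] at h3
        exact hg h3)
      have h3 : y ^ 2 ∈ T := by
        have := mul_mem h2 (inv_mem h1)
        convert this using 1
        rw [pow_two]
        group
      exact hy ((hmem y).2 (((hmem _).1 h3).of_pow _root_.two_ne_zero))
  | add x y hx hy => rw [mul_add, add_mul, hx, hy, add_zero]
  | smul c x hx => rw [mul_smul_comm, smul_mul_assoc, hx, smul_zero]

/-- With f = e − ee*, the elements ee* and f + f* are symmetric idempotents, hence central. Since
fRf* = f*Rf = 0, centrality of f + f* passes to f, and e = f + ee*. -/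
theorem commute_of_isIdempotentElem_of_commutative {e : MonoidAlgebra F G}
    (he : e ∈ subgroupAlgebra F T) (hi : IsIdempotentElem e) (r : MonoidAlgebra F G) :
    Commute e r := by
  have he' := star_mem_subgroupAlgebra he
  have hc : Commute e (star e) := commute_of_mem_subgroupAlgebra hT he he'
  have hi' : star e * star e = star e := by rw [← star_mul, hi.eq]
  have hq : IsIdempotentElem (e * star e) := by
    rw [IsIdempotentElem, hc.symm.mul_mul_mul_comm, hi.eq, hi']
  have hqc := H.commute_of_isIdempotentElem hq (by rw [star_mul, star_star]) r
  set f := e - e * star e with hf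
  have hff : f ∈ subgroupAlgebra F T := sub_mem he (mul_mem he he')
  have hfs : star f = star e - e * star e := by rw [hf, star_sub, star_mul, star_star]
  have hA : e * (e * star e) = e * star e := by rw [← mul_assoc, hi.eq]
  have hB : e * star e * e = e * star e := by rw [mul_assoc, ← hc.eq, hA]
  have hC : e * star e * star e = e * star e := by rw [mul_assoc, hi']
  have hD : star e * (e * star e) = e * star e := by rw [hc.eq, ← mul_assoc, hi']
  have hfi : IsIdempotentElem f := by
    rw [IsIdempotentElem, hf, mul_sub, sub_mul, sub_mul, hi.eq, hA, hB, hq.eq]; simp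
  have hf0 : f * star f = 0 := by
    rw [hfs, hf, mul_sub, sub_mul, sub_mul, hA, hC, hq.eq]; simp
  have hf0' : star f * f = 0 := by
    rw [← (commute_of_mem_subgroupAlgebra hT hff (star_mem_subgroupAlgebra hff)).eq, hf0]
  have hfi' : IsIdempotentElem (star f) := by rw [IsIdempotentElem, ← star_mul, hfi.eq]
  have h1 := H.mul_mul_star_eq_zero hmem hT hff hfi hf0 r
  have h2 := H.mul_mul_star_eq_zero hmem hT (star_mem_subgroupAlgebra hff) hfi'
    (by rw [star_star, hf0']) r
  rw [star_star] at h2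
  have hsum : IsIdempotentElem (f + star f) := by
    rw [IsIdempotentElem, mul_add, add_mul, add_mul, hfi.eq, hfi'.eq, hf0, hf0']; simp
  have h3 := (H.commute_of_isIdempotentElem hsum (by rw [star_add, star_star, add_comm]) r).eq
  have hfr : Commute f r := by
    have h4 : f * r = f * r * f := by
      calc f * r = f * (f + star f) * r := by rw [mul_add, hfi.eq, hf0, add_zero]
        _ = f * r * f + f * r * star f := by rw [mul_assoc, h3]; simp only [mul_add, mul_assoc]
        _ = f * r * f := by rw [h1, add_zero]
    have h5 : r * f = f * r * f := by
      calc r * f = r * ((f + star f) * f) := by rw [add_mul, hfi.eq, hf0', add_zero]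
        _ = f * r * f + star f * r * f := by rw [← mul_assoc, ← h3]; simp only [add_mul]
        _ = f * r * f := by rw [h2, add_zero]
    exact h4.trans h5.symm
  have : e = f + e * star e := by rw [hf, sub_add_cancel]
  rw [this]
  exact hfr.add_left hqc

end Abelian

end SymmetricIdentity

/-! ### Square-zero elements from the quaternion group; the nonabelian case. -/

section Quaternion

variable {R : Type*} [Ring R] {y P k : R}

/-- After multiplication by y, P and k anticommute with squares 1 and −1, so P + k squares to zero.
-/
lemma mul_self_eq_zero_of_anticommute (hP : Commute P y) (hk : Commute k y) (hyP : y * (P * P) = y)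
    (hyk : y * (k * k) = -y) (h : y * (k * P) = -(y * (P * k))) :
    y * (P + k) * (y * (P + k)) = 0 := by
  calc y * (P + k) * (y * (P + k)) = y * ((P + k) * y) * (P + k) := by simp only [mul_assoc]
    _ = y * (y * (P * P) + y * (P * k) + y * (k * P) + y * (k * k)) := by
      rw [(hP.add_left hk).eq]; noncomm_ring
    _ = 0 := by rw [hyP, hyk, h]; simp

lemma mul_mul_eq_of_anticommute (hy : y * y = 2 • y) (hP : Commute P y) (hk : Commute k y)
    (hyP : y * (P * P) = y) (hyk : y * (k * k) = -y) (h : y * (k * P) = -(y * (P * k))) :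
    y * (-P + k) * (y * (P + k)) * (y * (-P + k)) = -(16 • (y * (-P + k))) := by
  have hPk : y * (P * k * (-P + k)) = y * (-P + k) := by
    calc y * (P * k * (-P + k)) = P * (y * (k * k) - y * (k * P)) := by
          rw [mul_sub, ← mul_assoc P y, ← mul_assoc P y, hP.eq]; noncomm_ring
      _ = y * (P * P) * k - y * P := by
          rw [hyk, h, sub_neg_eq_add, mul_add, mul_neg, hP.eq, ← mul_assoc P y, hP.eq]; noncomm_ring
      _ = y * (-P + k) := by rw [hyP]; noncomm_ring
  have h1 : y * (-P + k) * (y * (P + k)) = -(4 • y) - 4 • (y * (P * k)) := by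
    calc y * (-P + k) * (y * (P + k)) = y * ((-P + k) * y) * (P + k) := by simp only [mul_assoc]
      _ = y * y * ((-P + k) * (P + k)) := by
        rw [(hP.neg_left.add_left hk).eq]; simp only [mul_assoc]
      _ = 2 • (-(y * (P * P)) - y * (P * k) + y * (k * P) + y * (k * k)) := by
        rw [hy]; noncomm_ring
      _ = _ := by rw [hyP, hyk, h]; noncomm_ring
  calc _ = -(4 • (y * y * (-P + k))) - 4 • (y * (P * k * y) * (-P + k)) := by
        rw [h1]; noncomm_ring
    _ = -(4 • (y * y * (-P + k))) - 4 • (y * y * (P * k * (-P + k))) := by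
        rw [(hP.mul_left hk).eq]; simp only [mul_assoc]
    _ = -(8 • (y * (-P + k))) - 8 • (y * (P * k * (-P + k))) := by
        rw [hy]; noncomm_ring
    _ = _ := by rw [hPk]; noncomm_ring

end Quaternion

namespace SymmetricIdentity

open MonoidAlgebra

variable {F G : Type*} [Field F] [Group G] {w : FreeGroup ℕ}
  (H : SymmetricIdentity F (MonoidAlgebra F G) w) (p : ℕ) [hp : Fact p.Prime] [hF : CharP F p]

include H hp hF

/-- An element of odd order commuting with a copy of the quaternion group is trivial. -/
theorem eq_one_of_commute_quaternion {a b c : G} (hab : a * b ≠ b * a) (ha4 : a ^ 4 = 1)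
    (hab2 : a ^ 2 = b ^ 2) (habc : a * b * a⁻¹ = b⁻¹) (hc : Odd (orderOf c)) (hca : Commute c a)
    (hcb : Commute c b) : c = 1 := by
  have := hp
  have hb4 : b ^ 4 = 1 := by
    rw [show 4 = 2 * 2 from rfl, pow_mul, ← hab2, ← pow_mul]; exact ha4
  obtain ⟨α, β, hαβ⟩ : ∃ α β : F, α ^ 2 + β ^ 2 = -1 := by
    obtain ⟨a', b', h⟩ := ZMod.sq_add_sq p (-1)
    refine ⟨ZMod.castHom dvd_rfl F a', ZMod.castHom dvd_rfl F b', ?_⟩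
    rw [← map_pow, ← map_pow, ← map_add, h, map_neg, map_one]
  set i := of F G a with hi
  set j := of F G b with hj
  set z := of F G (a ^ 2) with hz
  set k := of F G (a * b) with hk
  -- After multiplication by 1 − z the element z acts as −1, so P² = (α² + β²)z acts as 1.
  set P := α • i + β • j with hP
  have hii : i * i = z := by rw [hi, hz, ← map_mul, pow_two]
  have hjj : j * j = z := by rw [hj, hz, ← map_mul, hab2, pow_two]
  have hzz : z * z = 1 := by rw [hz, ← map_mul, ← pow_add, ha4, map_one]
  have hba : b * a = a ^ 2 * (a * b) := by
    have h1 : a * b = b⁻¹ * a := mul_inv_eq_iff_eq_mul.1 habc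
    rw [h1, hab2]
    group
  have hij : i * j = k := by rw [hi, hj, hk, ← map_mul]
  have hji : j * i = z * k := by rw [hi, hj, hk, hz, ← map_mul, ← map_mul, hba]
  have hzi : Commute z i := by rw [← hii]; exact (Commute.refl i).mul_left (Commute.refl i)
  have hzj : Commute z j := by rw [← hjj]; exact (Commute.refl j).mul_left (Commute.refl j)
  have hzk : Commute z k := by rw [← hij]; exact hzi.mul_right hzj
  have hzP : Commute z P := (hzi.smul_right α).add_right (hzj.smul_right β)
  have hik : i * k = z * j := by rw [← hij, ← mul_assoc, hii]
  have hki : k * i = j := by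
    rw [← hij, mul_assoc, hji, ← mul_assoc, ← hzi.eq, mul_assoc, hik, ← mul_assoc, hzz, one_mul]
  have hjk : j * k = i := by
    rw [← hij, ← mul_assoc, hji, ← hij, mul_assoc, mul_assoc, hjj, ← hzi.eq, ← mul_assoc, hzz,
      one_mul]
  have hkj : k * j = z * i := by rw [← hij, mul_assoc, hjj, hzi.eq]
  have hkk : k * k = z := by
    nth_rewrite 1 [← hij]
    rw [mul_assoc, hjk, hii]
  set y := 1 - z with hy
  have hzy : z * y = -y := by rw [hy, mul_sub, mul_one, hzz]; abel
  have hyz : y * z = -y := by rw [hy, sub_mul, one_mul, hzz]; abel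
  have hyy : y * y = 2 • y := by
    nth_rewrite 1 [hy]
    rw [sub_mul, one_mul, hzy]; abel
  have hPy : Commute P y := (Commute.one_right P).sub_right hzP.symm
  have hky : Commute k y := (Commute.one_right k).sub_right hzk.symm
  have hPP : y * (P * P) = y := by
    have h1 : P * P = (α ^ 2 + β ^ 2) • z + (α * β) • ((1 + z) * k) := by
      rw [hP]
      simp only [add_mul, mul_add, smul_mul_smul_comm, hii, hjj, hij, hji, one_mul, smul_add,
        add_smul, mul_comm β α, pow_two]
      abel
    have h2 : y * (1 + z) = 0 := by rw [mul_add, mul_one, hyz]; simp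
    rw [h1, hαβ, mul_add, mul_smul_comm, mul_smul_comm, ← mul_assoc, h2, hyz]
    simp
  have hykk : y * (k * k) = -y := by rw [hkk, hyz]
  have hykP : y * (k * P) = -(y * (P * k)) := by
    rw [hP]
    simp only [add_mul, mul_add, smul_mul_assoc, mul_smul_comm, hki, hkj, hik, hjk]
    rw [← mul_assoc, ← mul_assoc, hyz, neg_mul, neg_mul, smul_neg, smul_neg]
    abel
  have hsi : star i = z * i := by
    rw [hi, hz, star_of, ← map_mul, ← pow_succ, inv_eq_of_mul_eq_one_left]
    rw [← pow_succ]; exact ha4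
  have hsj : star j = z * j := by
    rw [hj, hz, star_of, ← map_mul, hab2, ← pow_succ, inv_eq_of_mul_eq_one_left]
    rw [← pow_succ]; exact hb4
  have hsz : star z = z := by
    rw [hz, star_of, inv_eq_of_mul_eq_one_left]
    rw [← pow_add]; exact ha4
  have hsk : star k = z * k := by
    rw [← hij, star_mul, hsi, hsj, mul_assoc, ← mul_assoc j, ← hzj.eq, mul_assoc, ← mul_assoc z z,
      hzz, one_mul, hji, hij]
  have hsy : star y = y := by rw [hy, star_sub, star_one, hsz]
  have hsP : star P = z * P := by
    rw [hP, star_add, H.star_smul, H.star_smul, hsi, hsj, mul_add, mul_smul_comm, mul_smul_comm]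
  have hsym : ∀ q, star q = z * q → Commute q y → star (y * q) = -(y * q) := by
    intro q hq hqy
    rw [star_mul, hsy, hq, mul_assoc, hqy.eq, ← mul_assoc, hzy, neg_mul]
  set s := y * (P + k) with hs
  set t := y * (-P + k) with ht
  have hss : star s = -s := hsym _ (by rw [star_add, hsP, hsk, mul_add z P k]) (hPy.add_left hky)
  have hst : star t = -t := hsym _ (by rw [star_add, star_neg, hsP, hsk, mul_add z (-P) k, mul_neg z P])
    (hPy.neg_left.add_left hky)
  have hs2 : s * s = 0 := mul_self_eq_zero_of_anticommute hPy hky hPP hykk hykP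
  have ht2 : t * t = 0 := mul_self_eq_zero_of_anticommute hPy.neg_left hky
    (by rw [neg_mul_neg, hPP]) hykk (by rw [mul_neg, mul_neg, hykP, neg_mul, mul_neg])
  have htst : t * s * t = -(16 • t) := mul_mul_eq_of_anticommute hyy hPy hky hPP hykk hykP
  -- s and t are skew; the skew factor η, which commutes with them, makes sη and tη symmetric.
  set η := of F G c - of F G c⁻¹ with hη
  have hcomm : ∀ {g : G}, Commute c g → Commute η (of F G g) := fun {g} h =>
    Commute.sub_left (h.map (of F G)) (h.inv_left.map (of F G))
  have hηi : Commute η i := hcomm hca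
  have hηj : Commute η j := hcomm hcb
  have hηz : Commute η z := hcomm (hca.pow_right 2)
  have hηk : Commute η k := hcomm (hca.mul_right hcb)
  have hηy : Commute η y := (Commute.one_right η).sub_right hηz
  have hηP : Commute η P := (hηi.smul_right α).add_right (hηj.smul_right β)
  have hηs : Commute η s := hηy.mul_right (hηP.add_right hηk)
  have hηt : Commute η t := hηy.mul_right (hηP.neg_right.add_right hηk)
  have hsη : star η = -η := by rw [hη, star_sub, star_of, star_of, inv_inv, neg_sub]
  have h1 := H.star_mul_mul_eq_zero (a := s * η) (c := t * η)
    (by rw [hηs.mul_mul_mul_comm, hs2, zero_mul])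
    (by rw [star_mul, hsη, hss, neg_mul_neg, hηs.eq])
    (by rw [star_mul, hsη, hst, neg_mul_neg, hηt.eq, hηt.mul_mul_mul_comm, ht2, zero_mul])
  have h2 : η ^ 3 * t = 0 := by
    have h3 : t * s * t * η ^ 3 = 0 := by
      rw [← h1, star_mul, hsη, hst, neg_mul_neg, hηt.eq, hηs.mul_mul_mul_comm,
        (hηt.mul_left hηt).mul_mul_mul_comm, pow_succ, pow_two]
    rw [htst, neg_mul, neg_eq_zero, smul_mul_assoc, ← Nat.cast_smul_eq_nsmul F, smul_eq_zero] at h3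
    rw [(hηt.pow_left 3).eq]
    refine h3.resolve_left ?_
    have : ((16 : ℕ) : F) = 2 ^ 4 := by norm_num
    rw [this]
    exact pow_ne_zero 4 H.two_ne_zero
  set C := Subgroup.zpowers c with hC
  have hcC : c ∈ C := Subgroup.mem_zpowers c
  have hC4 : ∀ u, u ^ 4 = 1 → u ∈ C → u = 1 := by
    intro u hu huC
    have h3 : Nat.Coprime (orderOf c) 4 := by
      have : Nat.Coprime (orderOf c) (2 ^ 2) := hc.coprime_two_right.pow_right 2
      exact this
    exact orderOf_eq_one_iff.1 (Nat.eq_one_of_dvd_coprimes h3 (orderOf_dvd_of_mem_zpowers huC)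
      (orderOf_dvd_of_pow_eq_one hu))
  have haC : a ∉ C := fun h => hab (by rw [hC4 a ha4 h]; simp)
  have hbC : b ∉ C := fun h => hab (by rw [hC4 b hb4 h]; simp)
  have ha2C : a ^ 2 ∉ C := fun h => hab (by
    rw [hba, hC4 (a ^ 2) (by rw [← pow_mul, mul_comm, pow_mul, ha4, one_pow]) h, one_mul])
  have hηC : η ^ 3 ∈ subgroupAlgebra F C :=
    pow_mem (sub_mem (of_mem_subgroupAlgebra hcC) (of_mem_subgroupAlgebra (inv_mem hcC))) 3
  -- η³ is supported on C = ⟨c⟩, and of the six terms of t only ab lies in the coset C·ab. The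
  -- coefficients of η³t there are those of η³.
  have hη3 : η ^ 3 = 0 := by
    ext x
    rw [coeff_zero, Finsupp.zero_apply]
    by_cases hx : x ∈ C
    · have hq : ∀ q : G, a * b * q⁻¹ ∉ C → (η ^ 3 * of F G q).coeff (x * (a * b)) = 0 := by
        intro q hq
        rw [coeff_mul_of]
        refine coeff_eq_zero_of_mem_subgroupAlgebra hηC ?_
        rwa [mul_assoc, C.mul_mem_cancel_left hx]
      have h3 := congrArg (fun r => r.coeff (x * (a * b))) h2
      have h4 : t = of F G (a * b) - α • of F G a - β • of F G b + α • of F G (a ^ 2 * a) +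
          β • of F G (a ^ 2 * b) - of F G (a ^ 2 * (a * b)) := by
        rw [ht, hy, hP, map_mul _ (a ^ 2) a, map_mul _ (a ^ 2) b, map_mul _ (a ^ 2) (a * b), ← hi, ← hj, ← hk, ← hz]
        simp only [sub_mul, one_mul, mul_add, mul_neg, mul_smul_comm, smul_sub]
        abel
      have e1 := hq a (by rw [habc]; exact fun h => hbC (inv_mem_iff.1 h))
      have e2 := hq b (by rw [mul_inv_cancel_right]; exact haC)
      have e3 := hq (a ^ 2 * a) (by
        rw [mul_inv_rev, ← mul_assoc, habc, hab2, ← mul_inv_rev, ← pow_succ,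
          inv_eq_of_mul_eq_one_left (a := b)]
        · exact hbC
        · rw [← pow_succ']; exact hb4)
      have e4 := hq (a ^ 2 * b) (by
        rw [mul_inv_rev, ← mul_assoc, mul_inv_cancel_right]
        intro h
        refine haC (inv_mem_iff.1 ?_)
        convert h using 1
        group)
      have e5 := hq (a ^ 2 * (a * b)) (by
        rw [mul_inv_rev, ← mul_assoc, mul_inv_cancel, one_mul]
        exact fun h => ha2C (inv_mem_iff.1 h))
      rw [h4] at h3
      simp only [mul_sub, mul_add, mul_smul_comm, coeff_sub, coeff_add, Finsupp.sub_apply,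
        Finsupp.add_apply, coeff_smul_apply, e1, e2, e3, e4, e5, smul_zero, sub_zero,
        add_zero, coeff_mul_of, mul_inv_cancel_right, coeff_zero, Finsupp.zero_apply] at h3
      exact h3
    · exact coeff_eq_zero_of_mem_subgroupAlgebra hηC hx
  have hcη : of F G c * η = of F G (c ^ 2) - 1 := by
    rw [hη, mul_sub, ← map_mul, ← map_mul, mul_inv_cancel, map_one, pow_two]
  have h3 : (of F G (c ^ 2) - 1) ^ 3 = 0 := by
    rw [← hcη, (hcomm (Commute.refl c)).symm.mul_pow, hη3, mul_zero]
  have hp2 : p ≠ 2 := by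
    rintro rfl
    have := CharP.cast_eq_zero F 2
    exact H.two_ne_zero (by exact_mod_cast this)
  have hp3 : 3 ≤ p := by
    have := hp.out.two_le
    omega
  -- As p ≥ 3, Frobenius turns this into c²ᵖ = 1.
  have h4 : (of F G (c ^ 2) - 1) ^ p = 0 := pow_eq_zero_of_le hp3 h3
  have : CharP (MonoidAlgebra F G) p := charP_of_injective_algebraMap' F p
  rw [sub_pow_char_of_commute _ (Commute.one_right _), one_pow, sub_eq_zero, ← map_pow,
    ← map_one (of F G)] at h4
  have h5 : c ^ 2 = 1 := H.eq_one_of_pow_char p (of_injective h4)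
  have h6 : orderOf c ∣ 2 := orderOf_dvd_of_pow_eq_one h5
  exact orderOf_eq_one_iff.1 (Nat.eq_one_of_dvd_coprimes hc.coprime_two_right dvd_rfl h6)

/-- If the torsion subgroup is not abelian, then it is a Hamiltonian `2`-group. -/
theorem isHamiltonian_and_isPGroup {T : Subgroup G} (hmem : ∀ g, g ∈ T ↔ IsOfFinOrder g)
    (hT : ¬ ∀ a b : T, a * b = b * a) : IsHamiltonian T ∧ IsPGroup 2 T := by
  have hn : ∀ g : T, (Subgroup.zpowers g).Normal := by
    intro g
    have h1 := H.zpowers_normal p ((hmem g).1 g.2)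
    have h2 : Subgroup.zpowers g = (Subgroup.zpowers (g : G)).subgroupOf T := by
      ext x
      simp [Subgroup.mem_subgroupOf, Subgroup.mem_zpowers_iff, Subtype.ext_iff]
    rw [h2]
    infer_instance
  have ht : ∀ g : T, IsOfFinOrder g := fun g =>
    (Submonoid.isOfFinOrder_coe (H := T.toSubmonoid)).1 ((hmem g).1 g.2)
  refine ⟨⟨hT, fun K => ⟨fun k hk g => ?_⟩⟩, fun t => ?_⟩
  · exact (Subgroup.zpowers_le.2 hk) ((hn k).conj_mem k (Subgroup.mem_zpowers k) g)
  obtain ⟨a, b, hab, ha4, hab2, habc⟩ := exists_quaternion hn ht hT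
  obtain ⟨k, m, hm, hkm⟩ := Nat.exists_eq_two_pow_mul_odd (ht t).orderOf_pos.ne'
  have hco : orderOf (t ^ 2 ^ k) = m := by
    rw [orderOf_pow_of_dvd (by positivity) ⟨m, hkm⟩, hkm, Nat.mul_div_cancel_left _ (by positivity)]
  -- The odd part of t and x generate normal subgroups of coprime orders, hence with trivial
  -- intersection.
  have hcomm : ∀ x : T, x ^ 4 = 1 → Commute (t ^ 2 ^ k) x := by
    intro x hx
    refine Subgroup.commute_of_normal_of_disjoint _ _ (hn (t ^ 2 ^ k)) (hn x) ?_ _ _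
      (Subgroup.mem_zpowers _) (Subgroup.mem_zpowers _)
    rw [Subgroup.disjoint_def]
    intro y hy1 hy2
    have h1 := orderOf_dvd_of_mem_zpowers hy1
    have h2 := (orderOf_dvd_of_mem_zpowers hy2).trans (orderOf_dvd_of_pow_eq_one hx)
    rw [hco] at h1
    have h3 : Nat.Coprime m 4 := by
      have : Nat.Coprime m (2 ^ 2) := hm.coprime_two_right.pow_right 2
      exact this
    exact orderOf_eq_one_iff.1 (Nat.eq_one_of_dvd_coprimes h3 h1 h2)
  refine ⟨k, ?_⟩
  have hb4 : b ^ 4 = 1 := by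
    rw [show 4 = 2 * 2 from rfl, pow_mul, ← hab2, ← pow_mul]; exact ha4
  have h1 := H.eq_one_of_commute_quaternion p (a := (a : G)) (b := (b : G))
    (c := ((t ^ 2 ^ k : T) : G)) (fun h => hab (Subtype.ext h))
    (congrArg Subtype.val ha4) (congrArg Subtype.val hab2) (congrArg Subtype.val habc)
    (by rw [Subgroup.orderOf_coe, hco]; exact hm)
    (congrArg Subtype.val (hcomm a ha4)) (congrArg Subtype.val (hcomm b hb4))
  exact Subtype.ext h1

end SymmetricIdentity

end GroupAlg

theorem lemma5 (w : FreeGroup ℕ) (hw : w ≠ 1) :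
    ∃ d : ℕ, 0 < d ∧
      ∀ (F : Type u) [Field F] (G : Type v) [Group G],
        2 < ringChar F →
        RingIsSemiprime (MonoidAlgebra F G) →
        GroupAlg.SatisfiesWord (GroupAlg.symmUnits F G) w →
        (d : ℕ∞) < ENat.card F →
        ∃ T : Subgroup G, (T : Set G) = {g : G | IsOfFinOrder g} ∧
          (((∀ a b : T, a * b = b * a) ∧
              ∀ e ∈ GroupAlg.subgroupAlgebra F T, IsIdempotentElem e →
                e ∈ Subalgebra.center F (MonoidAlgebra F G)) ∨
            ((GroupAlg.IsHamiltonian T ∧ IsPGroup 2 T) ∧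
              ∀ e ∈ GroupAlg.subgroupAlgebra F T, IsIdempotentElem e → GroupAlg.invol e = e →
                e ∈ Subalgebra.center F (MonoidAlgebra F G))) := by
  -- The nilpotency index is 3|ω| and the corner theorem needs more than four times as many scalars;
  -- the extra 12 covers the smaller bounds used elsewhere.
  refine ⟨12 * (w.toWord.length + 1), by positivity, fun F _ G _ hp hR hword hcard => ?_⟩
  have hprime : Fact (ringChar F).Prime :=
    ⟨(CharP.char_is_prime_or_zero F (ringChar F)).resolve_right (by omega)⟩
  have H : GroupAlg.SymmetricIdentity F (MonoidAlgebra F G) w :=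
    { ne_one := hw
      word := hword
      semiprime := GroupAlg.isSemiprimeElementwise_of_ringIsSemiprime hR
      two_ne_zero := Ring.two_ne_zero (by omega)
      star_smul := GroupAlg.star_smul_monoidAlgebra
      lt_card := hcard }
  obtain ⟨T, hT⟩ := H.exists_torsion (ringChar F)
  refine ⟨T, Set.ext hT, ?_⟩
  by_cases hcomm : ∀ a b : T, a * b = b * a
  · refine Or.inl ⟨hcomm, fun e he hi => Subalgebra.mem_center_iff.2 fun r => ?_⟩
    exact (H.commute_of_isIdempotentElem_of_commutative hT
      (fun x hx y hy => congrArg Subtype.val (hcomm ⟨x, hx⟩ ⟨y, hy⟩)) he hi r).symm.eq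
  · refine Or.inr ⟨H.isHamiltonian_and_isPGroup (ringChar F) hT hcomm,
      fun e _ hi hs => Subalgebra.mem_center_iff.2 fun r => ?_⟩
    exact (H.commute_of_isIdempotentElem hi hs r).symm.eq
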